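/- A plane tree with $e\ge 1$ edges is a triple $(H,\alpha,\sigma)$, where $H$ is a set of $2e$ half-edges, $\alpha$ is a fixed-point-free involution of $H$ (its cycles are the edges) and $\sigma$ is a permutation of $H$ with exactly $e+1$ cycles (the vertices; the degree of a vertex is the length of its cycle), such that $\langle\alpha,\sigma\rangle$ acts transitively on $H$. An $N$-rooted tree is a plane tree with a choice of half-edges $r_1,\dots,r_N$ (the roots) belonging to $N$ distinct vertices $v_1,\dots,v_N$. Two $N$-rooted trees are identified if there is a bijection between their sets of half-edges that commutes with $\alpha$ and $\sigma$ and maps the $k$th root to the $k$th root for every $k$. For $0\le k\le N$ let $T_N(e;d_1,\dots,d_k)$ be the number of $N$-rooted plane trees with $e$ edges in which $v_1,\dots,v_k$ have degrees $d_1,\dots,d_k$, the degrees of $v_{k+1},\dots,v_N$ being unrestricted; it is $0$ if there is no such tree. For $e=0$ the only tree is, by convention, the one consisting of a single vertex; it is $1$-rooted with root vertex of degree $0$, so that $T_1(0)=T_1(0;0)=1$ and all other $T_N(0;\dots)$ vanish. Theorem. Let $N\ge 1$, $e\ge 1$, $d_1,\dots,d_{N-1}\ge 0$ and $d_N\ge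 1$ be integers, where in the case $N=e=1$ we also assume $d_N=1$. Then $$T_N(e;d_1,\dots,d_N)=\sum_{i=1}^{N-1} d_i\,T_{N-1}(e-1;d_1,\dots,d_{i-1},d_i+d_N-2,d_{i+1},\dots,d_{N-1})+T_N(e-1;d_1,\dots,d_{N-1})-\sum_{d=1}^{d_N-2}T_N(e-1;d_1,\dots,d_{N-1},d),$$ where the last sum is empty if $d_N\le 2$. -/

import Mathlib

namespace PlaneTrees

/-- A plane tree with `e` edges. Its half-edges are the elements of `Fin (2 * e)`, the cycles of `α`
are the edges, and the cycles of `σ` (fixed points included) are the vertices, each with its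
cyclic (counterclockwise) order of half-edges. For `e = 0` there is no such structure. -/
structure PlaneTree (e : ℕ) where
  α : Equiv.Perm (Fin (2 * e))
  σ : Equiv.Perm (Fin (2 * e))
  α_involutive : ∀ h, α (α h) = h
  α_fixedPointFree : ∀ h, α h ≠ h
  transitive : MulAction.IsPretransitive (Subgroup.closure {α, σ}) (Fin (2 * e))
  card_vertices : Nat.card (Quotient (Equiv.Perm.SameCycle.setoid σ)) = 1 + e

/-- An `N`-rooted tree: a plane tree with `N` labelled root half-edges,
lying at `N` distinct vertices. -/
structure RootedTree (N e : ℕ) extends PlaneTree e where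
  root : Fin N → Fin (2 * e)
  root_vertices_distinct : ∀ i j, σ.SameCycle (root i) (root j) → i = j

variable {N e : ℕ}

/-- The degree of the `i`-th root vertex: the length of the cycle of `σ` containing the root. -/
noncomputable def RootedTree.degree (t : RootedTree N e) (i : Fin N) : ℕ :=
  {h | t.σ.SameCycle (t.root i) h}.ncard

/-- Isomorphism of `N`-rooted trees: a bijection of half-edges that is compatible with `α` and `σ`
and takes the `k`-th root to the `k`-th root. -/
def RootedTree.Iso (t t' : RootedTree N e) : Prop :=
  ∃ φ : Equiv.Perm (Fin (2 * e)),
    (∀ h, φ (t.α h) = t'.α (φ h)) ∧ (∀ h, φ (t.σ h) = t'.σ (φ h)) ∧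
      ∀ k, φ (t.root k) = t'.root k

theorem RootedTree.Iso.equivalence : Equivalence (RootedTree.Iso (N := N) (e := e)) where
  refl _ := ⟨1, fun _ => rfl, fun _ => rfl, fun _ => rfl⟩
  symm := by
    rintro t t' ⟨φ, h1, h2, h3⟩
    refine ⟨φ.symm, fun h => ?_, fun h => ?_, fun k => ?_⟩
    · rw [Equiv.symm_apply_eq, h1, Equiv.apply_symm_apply]
    · rw [Equiv.symm_apply_eq, h2, Equiv.apply_symm_apply]
    · rw [Equiv.symm_apply_eq, h3]
  trans := by
    rintro t t' t'' ⟨φ, h1, h2, h3⟩ ⟨ψ, g1, g2, g3⟩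
    exact ⟨φ.trans ψ, fun h => by simp [h1, g1], fun h => by simp [h2, g2],
      fun k => by simp [h3, g3]⟩

instance RootedTree.isoSetoid (N e : ℕ) : Setoid (RootedTree N e) :=
  ⟨RootedTree.Iso, RootedTree.Iso.equivalence⟩

/-- For `e > 0`, the set of isomorphism classes of `N`-rooted trees with `e` edges whose
first `k` root vertices have degrees `d 0, …, d (k - 1)`. -/
def treeClasses (N e : ℕ) {k : ℕ} (hk : k ≤ N) (d : Fin k → ℕ) :
    Set (Quotient (RootedTree.isoSetoid N e)) :=
  Quotient.mk (RootedTree.isoSetoid N e) '' {t | ∀ i : Fin k, t.degree (Fin.castLE hk i) = d i}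

/-- `T N e hk d` is the number of `N`-rooted plane trees with `e` edges, up to isomorphism, whose
first `k ≤ N` root vertices have the degrees prescribed by `d`; the degrees of the other root
vertices are free. For `e = 0` the only tree is the single vertex, by convention
a one-rooted tree whose root vertex has degree `0`. -/
noncomputable def T (N e : ℕ) {k : ℕ} (hk : k ≤ N) (d : Fin k → ℕ) : ℕ :=
  open Classical in
  if e = 0 then (if N = 1 ∧ ∀ i, d i = 0 then 1 else 0) else (treeClasses N e hk d).ncard

end PlaneTrees

/-! A rooted tree has no nontrivial automorphism, so an isomorphism class with `e` edges has exactly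
`(2 * e)!` labellings (`ncard_rootedTrees_eq_T_mul`), and the recurrence becomes an identity between
numbers of labelled trees.

Let `a` be the last root, of degree `p`, and let `b` be the other half of its edge. Fixing the
labels of `a` and `b` cancels a factor `2e(2e - 1)`, so that `(2e - 2)!` remains, the number of
labellings of a tree with one edge less. As there are no loops, the vertex of `b` is either another
root vertex `v_i`, whose root may then be moved to `b` at the cost of a factor `d i`, or it is no
root vertex, and `b` is adopted as a new root of arbitrary degree (`ncard_pointedTrees`).

In both cases the edge can be contracted, merging degrees `c` and `p` into `c + p - 2`
(`ncard_edgeTrees`). The contraction is decomposed into elementary bijections: half-edges are slid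
one by one from the vertex of `a` to that of `b`, until `a` is a leaf, and the leaf is deleted.

The first case gives the sum over `i`. The second gives the sum of `T_N(e - 1; d, D)` over all `D ≥
p - 1`, which is the sum over all `D` minus the terms with `1 ≤ D ≤ p - 2`. For `e = 1` the
contracted tree has no half-edges, its count is a convention, and the identity is checked directly.
-/

open Equiv Equiv.Perm

namespace PlaneTrees

/-! ### Labelled trees, relabelling and rigidity -/

section

variable {H H' ι : Type*}

/-- A setoid containing all pairs `(h, σ h)` contains the orbit relation of `σ`. -/
theorem setoid_of_sameCycle {σ : Perm H} (r : Setoid H) (hr : ∀ h, r h (σ h)) {u v : H}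
    (huv : σ.SameCycle u v) : r u v := by
  obtain ⟨i, rfl⟩ := huv
  induction i with
  | zero => exact r.refl _
  | succ n ih =>
    rw [add_comm, zpow_add, zpow_one, Perm.mul_apply]
    exact r.trans ih (hr _)
  | pred n ih =>
    refine r.trans ih (r.symm ?_)
    have := hr ((σ ^ (-(n : ℤ) - 1)) u)
    rwa [← Perm.mul_apply, ← zpow_one_add, add_sub_cancel] at this

/-- `α` and `σ` are the edge involution and the vertex rotation of a plane tree with set of
half-edges `H`; connectedness is expressed by invariant equivalence relations. -/
structure IsPlaneTree (α σ : Perm H) : Prop where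
  involutive : ∀ h, α (α h) = h
  fixedPointFree : ∀ h, α h ≠ h
  connected : ∀ r : Setoid H, (∀ h, r h (α h)) → (∀ h, r h (σ h)) → ∀ u v, r u v
  card_vertices : 2 * Nat.card (Quotient (SameCycle.setoid σ)) = 2 + Nat.card H

/-- The length of the cycle of `σ` through `h`. -/
noncomputable def vertexDegree (σ : Perm H) (h : H) : ℕ := {x | σ.SameCycle h x}.ncard

theorem vertexDegree_congr {σ : Perm H} {u v : H} (h : σ.SameCycle u v) :
    vertexDegree σ u = vertexDegree σ v := by
  unfold vertexDegree
  congr 1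
  ext x
  exact ⟨fun k => h.symm.trans k, fun k => h.trans k⟩

theorem vertexDegree_pos [Finite H] (σ : Perm H) (h : H) : 0 < vertexDegree σ h :=
  (Set.ncard_pos (Set.toFinite _)).2 ⟨h, SameCycle.refl _ _⟩

theorem vertexDegree_le [Finite H] (σ : Perm H) (h : H) : vertexDegree σ h ≤ Nat.card H :=
  (Set.ncard_le_ncard (Set.subset_univ _) (Set.toFinite _)).trans (Set.ncard_univ H).le

/-- Plane trees on the half-edge set `H` with roots indexed by `ι` at distinct vertices, whose
root degrees satisfy `P`. -/
def rootedTrees (ι H : Type*) (P : (ι → ℕ) → Prop) : Set (Perm H × Perm H × (ι → H)) :=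
  {t | IsPlaneTree t.1 t.2.1 ∧ (∀ i j, t.2.1.SameCycle (t.2.2 i) (t.2.2 j) → i = j) ∧
    P fun i => vertexDegree t.2.1 (t.2.2 i)}

/-- Transport of a rooted tree along a bijection of half-edges. -/
def relabel (ι : Type*) (φ : H ≃ H') :
    (Perm H × Perm H × (ι → H)) ≃ (Perm H' × Perm H' × (ι → H')) :=
  φ.permCongr.prodCongr (φ.permCongr.prodCongr ((Equiv.refl ι).arrowCongr φ))

theorem sameCycle_permCongr (φ : H ≃ H') (σ : Perm H) (u v : H) :
    (φ.permCongr σ).SameCycle (φ u) (φ v) ↔ σ.SameCycle u v := by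
  have key : ∀ i : ℤ, (φ.permCongr σ) ^ i = φ.permCongr (σ ^ i) := fun i =>
    (map_zpow φ.permCongrHom σ i).symm
  simp [SameCycle, key]

theorem vertexDegree_permCongr (φ : H ≃ H') (σ : Perm H) (u : H) :
    vertexDegree (φ.permCongr σ) (φ u) = vertexDegree σ u := by
  symm
  refine Set.ncard_congr (fun x _ => φ x) (fun x hx => (sameCycle_permCongr φ σ u x).2 hx)
    (fun x y _ _ h => φ.injective h) fun y hy => ⟨φ.symm y, ?_, by simp⟩
  have := sameCycle_permCongr φ σ u (φ.symm y)
  rw [φ.apply_symm_apply] at this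
  exact this.1 hy

theorem IsPlaneTree.permCongr {α σ : Perm H} (h : IsPlaneTree α σ) (φ : H ≃ H') :
    IsPlaneTree (φ.permCongr α) (φ.permCongr σ) where
  involutive x := by simp [h.involutive]
  fixedPointFree x hx := by
    refine h.fixedPointFree (φ.symm x) ?_
    rw [← φ.apply_eq_iff_eq]
    simpa using hx
  connected r h1 h2 u v := by
    have := h.connected (r.comap φ)
      (fun x => by simpa [Setoid.comap_rel] using h1 (φ x))
      (fun x => by simpa [Setoid.comap_rel] using h2 (φ x)) (φ.symm u) (φ.symm v)
    simpa [Setoid.comap_rel] using this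
  card_vertices := by
    rw [← Nat.card_congr φ, ← h.card_vertices]
    congr 1
    exact (Nat.card_congr (Quotient.congr φ fun a b => (sameCycle_permCongr φ σ a b).symm)).symm

theorem relabel_mem_of_mem {P : (ι → ℕ) → Prop} {t : Perm H × Perm H × (ι → H)} (φ : H ≃ H')
    (ht : t ∈ rootedTrees ι H P) : relabel ι φ t ∈ rootedTrees ι H' P := by
  obtain ⟨h1, h2, h3⟩ := ht
  refine ⟨h1.permCongr φ, fun i j hij => h2 i j ?_, ?_⟩
  · exact (sameCycle_permCongr φ _ _ _).1 hij
  · convert h3 using 2 with i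
    exact vertexDegree_permCongr φ _ _

theorem relabel_mem_iff {P : (ι → ℕ) → Prop} {t : Perm H × Perm H × (ι → H)} (φ : H ≃ H') :
    relabel ι φ t ∈ rootedTrees ι H' P ↔ t ∈ rootedTrees ι H P := by
  refine ⟨fun h => ?_, relabel_mem_of_mem φ⟩
  have := relabel_mem_of_mem φ.symm h
  convert this
  ext <;> simp [relabel]

theorem ncard_rootedTrees_congr (φ : H ≃ H') (P : (ι → ℕ) → Prop) :
    (rootedTrees ι H P).ncard = (rootedTrees ι H' P).ncard :=
  Nat.card_congr ((relabel ι φ).subtypeEquiv fun _ => (relabel_mem_iff φ).symm)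

/-- A rooted tree has no nontrivial automorphism. -/
theorem IsPlaneTree.rigid {α σ : Perm H} (h : IsPlaneTree α σ) (φ : Perm H)
    (hα : ∀ x, φ (α x) = α (φ x)) (hσ : ∀ x, φ (σ x) = σ (φ x)) {r : H} (hr : φ r = r) :
    φ = 1 := by
  ext x
  -- The relation has two classes, the fixed and the moved half-edges of `φ`; both `α` and `σ`
  -- preserve them.
  have := h.connected (Setoid.comap (fun u => φ u = u) ⊥)
    (fun u => by simp [hα]) (fun u => by simp [hσ]) r x
  simp only [Setoid.comap_rel, Setoid.bot_def, hr, eq_iff_iff, true_iff] at this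
  simpa using this

/-- There are `m (m - 1)` choices for the edge carrying a given root. -/
theorem ncard_rootedTrees_eq_mul [Finite H] [Finite ι] (P : (ι → ℕ) → Prop) (i : ι) {a b : H}
    (hab : a ≠ b) :
    (rootedTrees ι H P).ncard = (Nat.card H * (Nat.card H - 1)) *
      {t ∈ rootedTrees ι H P | t.2.2 i = a ∧ t.1 a = b}.ncard := by
  classical
  have := Fintype.ofFinite H
  have := Fintype.ofFinite ι
  set f : (Perm H × Perm H × (ι → H)) → H × H := fun t => (t.2.2 i, t.1 (t.2.2 i)) with hf
  have hmaps : Set.MapsTo f ((rootedTrees ι H P).toFinset : Set _)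
      ((Finset.univ : Finset H).offDiag : Set (H × H)) := by
    intro t ht
    simp only [Set.coe_toFinset] at ht
    simpa [hf] using (ht.1.fixedPointFree _).symm
  rw [Set.ncard_eq_toFinset_card', Finset.card_eq_sum_card_fiberwise hmaps]
  have hc : ∀ p ∈ (Finset.univ : Finset H).offDiag,
      Finset.card {t ∈ (rootedTrees ι H P).toFinset | f t = p} =
      {t ∈ rootedTrees ι H P | t.2.2 i = a ∧ t.1 a = b}.ncard := by
    rintro ⟨x, y⟩ hp
    have hxy : x ≠ y := by simpa using hp
    rw [← Set.ncard_coe_finset]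
    -- The symmetric group is 2-transitive: relabelling by `g` carries the fibre over `(x, y)` to
    -- the fibre over `(a, b)`.
    obtain ⟨g, hgx, hgy⟩ : ∃ g : Perm H, g x = a ∧ g y = b := by
      refine ⟨swap (swap x a y) b * swap x a, ?_, by simp⟩
      simp only [Perm.mul_apply, swap_apply_left]
      refine swap_apply_of_ne_of_ne (fun h => hxy ?_) hab
      have : swap x a x = swap x a y := by rw [swap_apply_left]; exact h
      exact (swap x a).injective this
    refine Nat.card_congr ((relabel ι g).subtypeEquiv fun t => ?_)
    have h1 : (relabel ι g t).2.2 i = a ↔ t.2.2 i = x := by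
      rw [← hgx]; simp [relabel, arrowCongr]
    have h2 : t.2.2 i = x → ((relabel ι g t).1 a = b ↔ t.1 x = y) := by
      intro _
      rw [← hgx, ← hgy]; simp [relabel]
    simp only [Finset.coe_filter, Set.mem_toFinset, Set.mem_ofPred_eq, relabel_mem_iff, hf,
      Prod.mk.injEq, h1]
    refine and_congr_right fun _ => and_congr_right fun h => ?_
    rw [h2 h, h]
  rw [Finset.sum_congr rfl hc, Finset.sum_const, smul_eq_mul, Finset.offDiag_card,
    Finset.card_univ, Nat.card_eq_fintype_card, Nat.mul_sub_one]

/-- The orbit relation of the generated group is the smallest equivalence relation preserved by both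
generators. In this form connectedness passes easily to modified permutations. -/
theorem isPretransitive_closure_pair_iff (α σ : Perm H) :
    MulAction.IsPretransitive (Subgroup.closure {α, σ}) H ↔
      ∀ r : Setoid H, (∀ h, r h (α h)) → (∀ h, r h (σ h)) → ∀ u v, r u v := by
  constructor
  · intro h r h1 h2 u v
    obtain ⟨⟨g, hg⟩, rfl⟩ := h.exists_smul_eq u v
    change r u (g u)
    induction hg using Subgroup.closure_induction generalizing u with
    | mem x hx =>
      rcases hx with rfl | rfl
      exacts [h1 _, h2 _]
    | one => exact r.refl _
    | mul x y _ _ hx hy => exact r.trans (hy u) (hx _)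
    | inv x _ hx => simpa using r.symm (hx (x⁻¹ u))
  · intro h
    refine ⟨fun u v => ?_⟩
    have := h (MulAction.orbitRel (Subgroup.closure {α, σ}) H)
      (fun x => (MulAction.orbitRel _ _).symm
        ⟨⟨α, Subgroup.subset_closure (by simp)⟩, rfl⟩)
      (fun x => (MulAction.orbitRel _ _).symm
        ⟨⟨σ, Subgroup.subset_closure (by simp)⟩, rfl⟩) v u
    exact this

variable {N e : ℕ}

theorem PlaneTree.isPlaneTree (t : PlaneTree e) : IsPlaneTree t.α t.σ where
  involutive := t.α_involutive
  fixedPointFree := t.α_fixedPointFree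
  connected := (isPretransitive_closure_pair_iff _ _).1 t.transitive
  card_vertices := by rw [t.card_vertices, Nat.card_fin, mul_add, mul_one]

/-- The labelled rooted tree underlying a `RootedTree`. -/
def RootedTree.toTriple (t : RootedTree N e) :
    Perm (Fin (2 * e)) × Perm (Fin (2 * e)) × (Fin N → Fin (2 * e)) := (t.α, t.σ, t.root)

/-- The rooted tree given by labelled data. -/
def RootedTree.ofTriple {P : (Fin N → ℕ) → Prop}
    (t : Perm (Fin (2 * e)) × Perm (Fin (2 * e)) × (Fin N → Fin (2 * e)))
    (ht : t ∈ rootedTrees (Fin N) (Fin (2 * e)) P) : RootedTree N e where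
  α := t.1
  σ := t.2.1
  α_involutive := ht.1.involutive
  α_fixedPointFree := ht.1.fixedPointFree
  transitive := (isPretransitive_closure_pair_iff _ _).2 ht.1.connected
  card_vertices := by
    have := ht.1.card_vertices
    rw [Nat.card_fin] at this
    omega
  root := t.2.2
  root_vertices_distinct := ht.2.1

theorem RootedTree.iso_iff (t t' : RootedTree N e) :
    t.Iso t' ↔ ∃ φ : Perm (Fin (2 * e)), relabel (Fin N) φ t.toTriple = t'.toTriple := by
  refine exists_congr fun φ => ?_
  simp only [relabel, toTriple, Equiv.prodCongr_apply, Prod.map_apply, Prod.mk.injEq,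
    Equiv.ext_iff, funext_iff, Equiv.permCongr_apply, Equiv.arrowCongr_apply, Function.comp_apply,
    Equiv.refl_symm, Equiv.coe_refl, id_eq]
  refine and_congr ⟨fun h x => ?_, fun h x => ?_⟩
    (and_congr ⟨fun h x => ?_, fun h x => ?_⟩ Iff.rfl)
  · simpa using h (φ.symm x)
  · simpa using h (φ x)
  · simpa using h (φ.symm x)
  · simpa using h (φ x)

/-- An isomorphism class of rooted trees with `e` edges has `(2 * e)!` labellings. -/
theorem ncard_rootedTrees_eq_T_mul {k : ℕ} (hk : k ≤ N) (d : Fin k → ℕ) (hN : 0 < N)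
    (he : e ≠ 0) :
    (rootedTrees (Fin N) (Fin (2 * e)) fun δ => ∀ i, δ (Fin.castLE hk i) = d i).ncard =
      T N e hk d * (2 * e).factorial := by
  classical
  rw [T, if_neg he]
  set S := rootedTrees (Fin N) (Fin (2 * e)) fun δ => ∀ i, δ (Fin.castLE hk i) = d i with hS
  have hmem : ∀ t : RootedTree N e,
      t.toTriple ∈ S ↔ ∀ i, t.degree (Fin.castLE hk i) = d i := fun t =>
    ⟨fun h => h.2.2, fun h => ⟨t.isPlaneTree, t.root_vertices_distinct, h⟩⟩
  have hout : ∀ c : treeClasses N e hk d, c.1.out.toTriple ∈ S := by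
    rintro ⟨_, t, ht, rfl⟩
    obtain ⟨φ, hφ⟩ := (RootedTree.iso_iff _ _).1 (Quotient.mk_out (s := RootedTree.isoSetoid N e) t)
    exact (relabel_mem_iff φ).1 (hφ ▸ (hmem t).2 ht)
  have hcard : Nat.card (Perm (Fin (2 * e))) = (2 * e).factorial := by
    rw [Nat.card_eq_fintype_card, Fintype.card_perm, Fintype.card_fin]
  rw [← hcard, ← Nat.card_coe_set_eq, ← Nat.card_coe_set_eq, ← Nat.card_prod]
  symm
  -- A class and a permutation give the relabelling of a chosen representative of the class;
  -- rigidity makes this injective.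
  refine Nat.card_congr (Equiv.ofBijective
    (fun p => ⟨relabel (Fin N) p.2 p.1.1.out.toTriple, (relabel_mem_iff p.2).2 (hout p.1)⟩)
    ⟨?_, ?_⟩)
  · rintro ⟨c, φ⟩ ⟨c', ψ⟩ h
    replace h : relabel (Fin N) φ c.1.out.toTriple = relabel (Fin N) ψ c'.1.out.toTriple :=
      congrArg Subtype.val h
    have h' : relabel (Fin N) (φ.trans ψ.symm) c.1.out.toTriple = c'.1.out.toTriple := by
      have := congrArg (relabel (Fin N) ψ.symm) h
      refine Eq.trans ?_ (this.trans ?_) <;> ext <;> simp [relabel]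
    have hc : c = c' := by
      refine Subtype.ext ?_
      rw [← c.1.out_eq, ← c'.1.out_eq]
      exact Quotient.sound ((RootedTree.iso_iff _ _).2 ⟨_, h'⟩)
    subst hc
    obtain ⟨g1, g2, g3⟩ : (∀ x, (φ.trans ψ.symm) (c.1.out.α x) = c.1.out.α ((φ.trans ψ.symm) x)) ∧
      (∀ x, (φ.trans ψ.symm) (c.1.out.σ x) = c.1.out.σ ((φ.trans ψ.symm) x)) ∧
      ∀ i, (φ.trans ψ.symm) (c.1.out.root i) = c.1.out.root i := by
      have e1 := congrArg Prod.fst h'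
      have e2 := congrArg (fun t => t.2.1) h'
      have e3 := congrArg (fun t => t.2.2) h'
      refine ⟨fun x => ?_, fun x => ?_, fun i => ?_⟩
      · have := congrArg (fun f => f ((φ.trans ψ.symm) x)) e1
        simpa [relabel, RootedTree.toTriple] using this
      · have := congrArg (fun f => f ((φ.trans ψ.symm) x)) e2
        simpa [relabel, RootedTree.toTriple] using this
      · exact congrFun e3 i
    -- Rigidity needs one fixed half-edge, here the root with index 0; hence `0 < N`.
    have := (PlaneTree.isPlaneTree _).rigid _ g1 g2 (g3 ⟨0, hN⟩)
    have : φ = ψ := by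
      ext x
      have := congrArg (fun f => ψ (f x)) this
      simpa using congrArg Fin.val this
    rw [this]
  · rintro ⟨t, ht⟩
    set t' := RootedTree.ofTriple t ht
    have ht' : t'.toTriple = t := rfl
    obtain ⟨φ, hφ⟩ :=
      (RootedTree.iso_iff _ _).1 (Quotient.mk_out (s := RootedTree.isoSetoid N e) t')
    exact ⟨(⟨Quotient.mk _ t', t', (hmem t').1 ht, rfl⟩, φ), Subtype.ext hφ⟩

end

/-! ### Absence of loops -/

section

variable {H H' ι : Type*}

/-- The graph of vertices of a pair of permutations. -/
def vertexGraph (α σ : Perm H) : SimpleGraph (Quotient (SameCycle.setoid σ)) :=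
  SimpleGraph.fromRel fun u v => ∃ h : H, ⟦h⟧ = u ∧ ⟦α h⟧ = v

theorem IsPlaneTree.vertexGraph_connected [Nonempty H] {α σ : Perm H} (h : IsPlaneTree α σ) :
    (vertexGraph α σ).Connected := by
  have key := h.connected (Setoid.comap (fun x : H => (⟦x⟧ : Quotient (SameCycle.setoid σ)))
    (vertexGraph α σ).reachableSetoid) (fun x => ?_) (fun x => ?_)
  · have : Nonempty (Quotient (SameCycle.setoid σ)) := ⟨⟦Classical.arbitrary H⟧⟩
    refine ⟨fun u v => ?_⟩
    induction u using Quotient.inductionOn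
    induction v using Quotient.inductionOn
    exact key _ _
  · by_cases hx : (⟦x⟧ : Quotient (SameCycle.setoid σ)) = ⟦α x⟧
    · change (vertexGraph α σ).Reachable ⟦x⟧ ⟦α x⟧
      rw [← hx]
    · exact SimpleGraph.Adj.reachable
        ((SimpleGraph.fromRel_adj _ _ _).2 ⟨hx, Or.inl ⟨x, rfl, rfl⟩⟩)
  · have hx : (⟦x⟧ : Quotient (SameCycle.setoid σ)) = ⟦σ x⟧ :=
      Quotient.sound ((SameCycle.refl σ x).apply_right)
    change (vertexGraph α σ).Reachable ⟦x⟧ ⟦σ x⟧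
    rw [← hx]

/-- A plane tree has no loops. -/
theorem IsPlaneTree.not_sameCycle [Finite H] {α σ : Perm H} (h : IsPlaneTree α σ) (a : H) :
    ¬ σ.SameCycle a (α a) := by
  classical
  intro ha
  have := Fintype.ofFinite H
  have : Nonempty H := ⟨a⟩
  let V := Quotient (SameCycle.setoid σ)
  let q : H → V := fun x => ⟦x⟧
  have : Fintype V := Fintype.ofFinite _
  have h1 := h.vertexGraph_connected.card_vert_le_card_edgeSet_add_one
  set f : H → Sym2 V := fun x => s(q x, q (α x)) with hf
  set E := (vertexGraph α σ).edgeSet with hE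
  -- Every edge of the simple graph uses at least two half-edges. A loop `{a, α a}` contributes
  -- none, so too few edges would be left to connect all the vertices.
  have h2 : 2 * E.toFinset.card ≤ ((Finset.univ.erase a).erase (α a)).card := by
    rw [mul_comm, ← smul_eq_mul, ← Finset.sum_const]
    have htwo : ∀ ε ∈ E.toFinset,
        2 ≤ Finset.card {x ∈ (Finset.univ.erase a).erase (α a) | f x = ε} := by
      intro ε hε
      rw [Set.mem_toFinset] at hε
      obtain ⟨x, hx1, hx2⟩ : ∃ x, q x ≠ q (α x) ∧ f x = ε := by
        induction ε using Sym2.ind with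
        | _ u v =>
          obtain ⟨huv, hx | hx⟩ := (SimpleGraph.fromRel_adj _ _ _).1
            ((SimpleGraph.mem_edgeSet _).1 hε)
          · obtain ⟨x, rfl, rfl⟩ := hx
            exact ⟨x, huv, rfl⟩
          · obtain ⟨x, rfl, rfl⟩ := hx
            exact ⟨x, huv.symm, Sym2.eq_swap⟩
      have hqa : q a = q (α a) := Quotient.sound (s := SameCycle.setoid σ) ha
      have hxa : x ≠ a := by rintro rfl; exact hx1 hqa
      have hxb : x ≠ α a := by rintro rfl; rw [h.involutive] at hx1; exact hx1 hqa.symm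
      refine Finset.one_lt_card.2 ⟨x, ?_, α x, ?_, (h.fixedPointFree x).symm⟩
      · simp [hxa, hxb, hx2]
      · have : α x ≠ a := fun k => hxb (by rw [← k, h.involutive])
        have h5 : f (α x) = ε := by rw [← hx2, hf]; simp [h.involutive, Sym2.eq_swap]
        simp [hxa, this, h5]
    refine (Finset.sum_le_sum htwo).trans ?_
    rw [← Finset.card_biUnion]
    · refine Finset.card_le_card fun x hx => ?_
      obtain ⟨ε, _, hx⟩ := Finset.mem_biUnion.1 hx
      exact (Finset.mem_filter.1 hx).1
    · intro ε _ ε' _ hne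
      rw [Function.onFun, Finset.disjoint_left]
      intro x hx hx'
      exact hne ((Finset.mem_filter.1 hx).2.symm.trans (Finset.mem_filter.1 hx').2)
  have h3 : E.toFinset.card = Nat.card E := by
    rw [Nat.card_eq_fintype_card, Set.toFinset_card]
  rw [Finset.card_erase_of_mem (by simp [h.fixedPointFree]), Finset.card_erase_of_mem (by simp),
    Finset.card_univ, ← Nat.card_eq_fintype_card] at h2
  have h4 := h.card_vertices
  have : 2 ≤ Nat.card H := by
    rw [Nat.card_eq_fintype_card]
    exact Fintype.one_lt_card_iff.2 ⟨a, α a, (h.fixedPointFree a).symm⟩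
  omega

/-! ### Moving a half-edge from one vertex to another -/

theorem vertexDegree_inv (σ : Perm H) (h : H) : vertexDegree σ⁻¹ h = vertexDegree σ h := by
  simp [vertexDegree]

/-- The cycles of `τ` arise from those of `σ` by moving `x` from the cycle of `b` to that of `a`. -/
structure Moves (a b x : H) (σ τ : Perm H) : Prop where
  ne_left : x ≠ a
  ne_right : x ≠ b
  source : σ.SameCycle b x
  target : τ.SameCycle a x
  sep_source : ¬ σ.SameCycle a b
  sep_target : ¬ τ.SameCycle a b
  sameCycle_iff : ∀ u v, u ≠ x → v ≠ x → (σ.SameCycle u v ↔ τ.SameCycle u v)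

namespace Moves

variable {a b x : H} {σ τ : Perm H}

theorem symm (h : Moves a b x σ τ) : Moves b a x τ σ where
  ne_left := h.ne_right
  ne_right := h.ne_left
  source := h.target
  target := h.source
  sep_source := fun k => h.sep_target k.symm
  sep_target := fun k => h.sep_source k.symm
  sameCycle_iff u v hu hv := (h.sameCycle_iff u v hu hv).symm

theorem inv (h : Moves a b x σ τ) : Moves a b x σ⁻¹ τ⁻¹ := by
  obtain ⟨h1, h2, h3, h4, h5, h6, h7⟩ := h
  constructor <;> simpa

/-- Moving `x` between the two ends of an edge keeps the tree connected, since that edge still joins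
the two vertices; the number of cycles is unchanged because neither end is emptied. -/
theorem isPlaneTree {α : Perm H} (h : Moves a b x σ τ) (ht : IsPlaneTree α σ) (hab : α a = b) :
    IsPlaneTree α τ where
  involutive := ht.involutive
  fixedPointFree := ht.fixedPointFree
  connected r h1 h2 := by
    have hτ : ∀ u v, τ.SameCycle u v → r u v := fun u v => setoid_of_sameCycle r h2
    have hrab : r a b := hab ▸ h1 a
    have hrx : r x b := r.trans (hτ _ _ h.target.symm) hrab
    have hσ : ∀ u v, σ.SameCycle u v → r u v := by
      have hx : ∀ v, v ≠ x → σ.SameCycle x v → r x v := fun v hv hxv =>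
        r.trans hrx (hτ _ _ ((h.sameCycle_iff b v h.ne_right.symm hv).1 (h.source.trans hxv)))
      intro u v huv
      by_cases hu : u = x
      · subst hu
        by_cases hv : v = u
        · exact hv ▸ r.refl _
        · exact hx v hv huv
      · by_cases hv : v = x
        · subst hv
          exact r.symm (hx u hu huv.symm)
        · exact hτ _ _ ((h.sameCycle_iff u v hu hv).1 huv)
    exact ht.connected r h1 fun u => hσ _ _ (SameCycle.refl σ u).apply_right
  card_vertices := by
    classical
    rw [← ht.card_vertices]
    congr 1
    -- In `τ` the half-edge `x` lies on the cycle of `a`, so replacing `x` by `a` turns cycles of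
    -- `τ` into cycles of `σ`.
    have hiff : ∀ u v, τ.SameCycle u v ↔
        σ.SameCycle (if u = x then a else u) (if v = x then a else v) := by
      intro u v
      have hxa : ∀ w, τ.SameCycle x w ↔ τ.SameCycle a w := fun w =>
        ⟨fun k => h.target.trans k, fun k => h.target.symm.trans k⟩
      have ha := h.ne_left.symm
      split_ifs with hu hv hv
      · simp [hu, hv, SameCycle.refl]
      · rw [hu, hxa, h.sameCycle_iff _ _ ha hv]
      · rw [hv, sameCycle_comm, hxa, sameCycle_comm, h.sameCycle_iff _ _ hu ha]
      · rw [h.sameCycle_iff _ _ hu hv]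
    refine Nat.card_congr (Equiv.ofBijective (Quotient.map' (fun u => if u = x then a else u)
      fun u v huv => (hiff u v).1 huv) ⟨?_, ?_⟩)
    · intro p q
      induction p using Quotient.inductionOn
      induction q using Quotient.inductionOn
      exact fun k => Quotient.sound ((hiff _ _).2 (Quotient.exact k))
    · intro q
      induction q using Quotient.inductionOn with
      | _ u =>
      by_cases hu : u = x
      · refine ⟨⟦b⟧, Quotient.sound ?_⟩
        change σ.SameCycle (if b = x then a else b) u
        rw [if_neg h.ne_right.symm, hu]
        exact h.source
      · refine ⟨⟦u⟧, Quotient.sound ?_⟩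
        change σ.SameCycle (if u = x then a else u) u
        rw [if_neg hu]

theorem vertexDegree_left [Finite H] (h : Moves a b x σ τ) :
    vertexDegree τ a = vertexDegree σ a + 1 := by
  unfold vertexDegree
  have hx : x ∉ {y | σ.SameCycle a y} := fun k => h.sep_source (k.trans h.source.symm)
  rw [← Set.ncard_insert_of_notMem hx (Set.toFinite _)]
  congr 1
  ext y
  by_cases hy : y = x
  · simp [hy, h.target]
  · simp [hy, h.sameCycle_iff a y h.ne_left.symm hy]

theorem vertexDegree_right [Finite H] (h : Moves a b x σ τ) :
    vertexDegree σ b = vertexDegree τ b + 1 := h.symm.vertexDegree_left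

theorem vertexDegree_of_not {y : H} (h : Moves a b x σ τ) (ha : ¬ σ.SameCycle a y)
    (hb : ¬ σ.SameCycle b y) : vertexDegree τ y = vertexDegree σ y := by
  have hyx : y ≠ x := by rintro rfl; exact hb h.source
  unfold vertexDegree
  congr 1
  ext z
  by_cases hz : z = x
  · subst hz
    have : ¬ σ.SameCycle y z := fun k => hb (h.source.trans k.symm)
    have h2 : ¬ τ.SameCycle y z := fun k =>
      ha ((h.sameCycle_iff a y h.ne_left.symm hyx).2 (h.target.trans k.symm))
    simp [this, h2]
  · simp [h.sameCycle_iff y z hyx hz]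

end Moves

/-! ### The slide and its inverse -/

variable [DecidableEq H]

/-- Move the half-edge following `b` in front of `a`. -/
def slide (a b : H) (σ : Perm H) : Perm H := swap a (σ b) * swap (σ b) (σ (σ b)) * σ

section

variable {a b : H} {σ : Perm H}

theorem slide_apply_right (h : ¬ σ.SameCycle a b) (hb : σ b ≠ b) :
    slide a b σ b = σ (σ b) := by
  have h2 : σ (σ b) ≠ a := by
    rintro rfl
    exact h (by simp [SameCycle.refl])
  have h3 : σ (σ b) ≠ σ b := fun k => hb (σ.injective k)
  simp [slide, swap_apply_of_ne_of_ne h2 h3]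

theorem slide_apply_moved : slide a b σ (σ b) = a := by
  simp [slide]

theorem slide_apply_of_ne {u : H} (h1 : u ≠ b) (h2 : u ≠ σ b) (h3 : σ u ≠ a) :
    slide a b σ u = σ u := by
  have h4 : σ u ≠ σ b := fun k => h1 (σ.injective k)
  have h5 : σ u ≠ σ (σ b) := fun k => h2 (σ.injective k)
  simp [slide, swap_apply_of_ne_of_ne h4 h5, swap_apply_of_ne_of_ne h3 h4]

theorem slide_apply_of_eq {u : H} (h : ¬ σ.SameCycle a b) (h1 : σ u = a) :
    slide a b σ u = σ b := by
  have h4 : a ≠ σ b := by rintro rfl; exact h (by simp [SameCycle.refl])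
  have h5 : a ≠ σ (σ b) := by rintro rfl; exact h (by simp [SameCycle.refl])
  simp [slide, h1, swap_apply_of_ne_of_ne h4 h5]

/-- Inverting the rotation exchanges "after" and "in front of": for the inverse rotation the moved
half-edge follows `a`, and sliding it back puts it in front of `b`. Thus the inverse of a slide is
again a slide, which yields both bijectivity and the converse of `sameCycle_of_slide`. -/
theorem slide_slide (h : ¬ σ.SameCycle a b) :
    slide b a (slide a b σ)⁻¹ = σ⁻¹ := by
  have h4 : σ⁻¹ a ≠ σ b := by
    intro k
    refine h ?_
    have : σ.SameCycle (σ⁻¹ a) a := by simp [SameCycle.refl]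
    rw [k] at this
    simpa using this.symm
  have h5 : σ⁻¹ a ≠ b := by
    intro k
    refine h ?_
    have : σ.SameCycle (σ⁻¹ a) a := by simp [SameCycle.refl]
    rw [k] at this
    exact this.symm
  set τ := slide a b σ with hτ
  have e1 : τ⁻¹ a = σ b := by rw [Perm.inv_eq_iff_eq]; exact (slide_apply_moved).symm
  have e2 : τ⁻¹ (σ b) = σ⁻¹ a := by
    rw [Perm.inv_eq_iff_eq]; exact (slide_apply_of_eq h (by simp)).symm
  rw [slide, e1, e2, hτ, slide, mul_inv_rev, mul_inv_rev, swap_inv, swap_inv]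
  -- Conjugation by `σ⁻¹` applies it to the entries of both transpositions.
  have e3 : σ⁻¹ * (swap (σ b) (σ (σ b)) * swap a (σ b)) =
      swap b (σ b) * swap (σ⁻¹ a) b * σ⁻¹ := by
    have := Equiv.mul_swap_eq_swap_mul σ⁻¹
    simp [mul_assoc, this, ← mul_assoc σ⁻¹]
  rw [e3]
  have e4 : swap b (σ b) * swap (σ b) (σ⁻¹ a) * swap b (σ b) = swap b (σ⁻¹ a) := by
    have := Equiv.mul_swap_eq_swap_mul (swap b (σ b)) (σ b) (σ⁻¹ a)
    rw [this, mul_assoc]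
    rw [swap_apply_right, swap_apply_of_ne_of_ne h5 h4, swap_mul_self, mul_one]
  rw [← mul_assoc, ← mul_assoc, e4, swap_comm]
  simp

theorem sameCycle_of_slide (h : ¬ σ.SameCycle a b) (hb : σ b ≠ b) {u v : H}
    (huv : (slide a b σ).SameCycle u v) :
    σ.SameCycle (if u = σ b then a else u) (if v = σ b then a else v) := by
  refine setoid_of_sameCycle (Setoid.comap (fun u => if u = σ b then a else u)
    (SameCycle.setoid σ)) (fun u => ?_) huv
  change σ.SameCycle (if u = σ b then a else u)
    (if slide a b σ u = σ b then a else slide a b σ u)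
  have hab : a ≠ σ b := by rintro rfl; exact h (by simp [SameCycle.refl])
  by_cases h1 : u = b
  · subst h1
    rw [slide_apply_right h hb, if_neg hb.symm, if_neg fun k => hb (σ.injective k)]
    simp [SameCycle.refl]
  by_cases h2 : u = σ b
  · rw [if_pos h2, h2, slide_apply_moved, if_neg hab]
  by_cases h3 : σ u = a
  · rw [slide_apply_of_eq h h3, if_pos rfl, if_neg h2, ← h3]
    simp [SameCycle.refl]
  · rw [slide_apply_of_ne h1 h2 h3, if_neg h2, if_neg fun k => h1 (σ.injective k)]
    simp [SameCycle.refl]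

theorem moves_slide (h : ¬ σ.SameCycle a b) (hb : σ b ≠ b) :
    Moves a b (σ b) σ (slide a b σ) := by
  have hab : a ≠ σ b := by rintro rfl; exact h (by simp [SameCycle.refl])
  have hsep : ¬ (slide a b σ).SameCycle a b := fun k => by
    have := sameCycle_of_slide h hb k
    rw [if_neg hab, if_neg hb.symm] at this
    exact h this
  refine ⟨hab.symm, hb, by simp [SameCycle.refl], ?_, h, hsep,
    fun u v hu hv => ⟨fun k => ?_, fun k => ?_⟩⟩
  · rw [sameCycle_comm]
    have := (SameCycle.refl (slide a b σ) (σ b)).apply_right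
    rwa [slide_apply_moved] at this
  · have e1 : (slide a b σ)⁻¹ a = σ b := by
      rw [Perm.inv_eq_iff_eq]; exact (slide_apply_moved).symm
    -- The reverse inclusion is the forward one for the inverse slide.
    have := sameCycle_of_slide (σ := (slide a b σ)⁻¹) (a := b) (b := a) (u := u) (v := v)
      (fun k => hsep (sameCycle_inv.1 k).symm) (by rw [e1]; exact hab.symm)
    rw [slide_slide h, e1, if_neg hu, if_neg hv] at this
    exact sameCycle_inv.1 (this (sameCycle_inv.2 k))
  · have := sameCycle_of_slide h hb k
    rwa [if_neg hu, if_neg hv] at this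

end

/-- Rooted plane trees with a distinguished edge `{a, b}`, where `b` is the `i₀`-th root and the
vertex of `a` is none of the root vertices. The roots have degrees `d` and `a` has degree `p`. -/
def edgeTrees (a b : H) (i₀ : ι) (d : ι → ℕ) (p : ℕ) : Set (Perm H × Perm H × (ι → H)) :=
  {t | t ∈ rootedTrees ι H (fun δ => δ = d) ∧ t.1 a = b ∧ t.2.2 i₀ = b ∧
    (∀ j, ¬ t.2.1.SameCycle a (t.2.2 j)) ∧ vertexDegree t.2.1 a = p}

omit [DecidableEq H] in
theorem moved_mem_edgeTrees [Finite H] [DecidableEq ι] {a b x : H} {i₀ : ι} {d : ι → ℕ} {p : ℕ}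
    {α σ τ : Perm H} {ρ : ι → H} (hm : Moves a b x σ τ) (ht : (α, σ, ρ) ∈ edgeTrees a b i₀ d p) :
    (α, τ, ρ) ∈ edgeTrees a b i₀ (Function.update d i₀ (d i₀ - 1)) (p + 1) := by
  obtain ⟨⟨h1, h2, rfl⟩, h3, h4, h5, rfl⟩ := ht
  dsimp only at h1 h2 h3 h4 h5
  -- The only root on the cycle of `b` is `b` itself, so the moved half-edge is never a root.
  have hx : ∀ j, ρ j ≠ x := by
    rintro j rfl
    have := h2 i₀ j (h4 ▸ hm.source)
    subst this
    exact hm.ne_right h4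
  refine ⟨⟨hm.isPlaneTree h1 h3, fun i j hij => h2 i j ?_, ?_⟩, h3, h4, fun j hj => h5 j ?_, ?_⟩
  · exact (hm.sameCycle_iff _ _ (hx i) (hx j)).2 hij
  · ext j
    by_cases hj : j = i₀
    · subst hj
      dsimp only
      rw [Function.update_self, h4, hm.vertexDegree_right]
      rfl
    · rw [Function.update_of_ne hj]
      refine hm.vertexDegree_of_not (h5 j) fun k => hj (h2 _ _ ?_)
      rw [h4]
      exact k.symm
  · exact (hm.sameCycle_iff _ _ hm.ne_left.symm (hx j)).2 hj
  · exact hm.vertexDegree_left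

omit [DecidableEq H] in
theorem unmoved_mem_edgeTrees [Finite H] [DecidableEq ι] {a b x : H} {i₀ : ι} {d : ι → ℕ} {p : ℕ}
    {α σ τ : Perm H} {ρ : ι → H} (hm : Moves a b x σ τ)
    (ht : (α, τ, ρ) ∈ edgeTrees a b i₀ d (p + 1)) :
    (α, σ, ρ) ∈ edgeTrees a b i₀ (Function.update d i₀ (d i₀ + 1)) p := by
  obtain ⟨⟨h1, h2, rfl⟩, h3, h4, h5, h6⟩ := ht
  dsimp only at h1 h2 h3 h4 h5 h6
  have hx : ∀ j, ρ j ≠ x := by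
    rintro j rfl
    exact h5 j hm.target
  have h3' : α b = a := by rw [← h3, h1.involutive]
  refine ⟨⟨hm.symm.isPlaneTree h1 h3', fun i j hij => h2 i j ?_, ?_⟩, h3, h4, fun j hj => h5 j ?_,
    ?_⟩
  · exact (hm.sameCycle_iff _ _ (hx i) (hx j)).1 hij
  · ext j
    by_cases hj : j = i₀
    · subst hj
      dsimp only
      rw [Function.update_self, h4, hm.vertexDegree_right]
    · rw [Function.update_of_ne hj]
      refine hm.symm.vertexDegree_of_not (fun k => hj (h2 _ _ ?_)) (h5 j)
      rw [h4]
      exact k.symm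
  · exact (hm.sameCycle_iff _ _ hm.ne_left.symm (hx j)).1 hj
  · have := hm.vertexDegree_left
    dsimp only
    omega

omit [DecidableEq H] in
theorem apply_ne_self_of_one_lt_vertexDegree {σ : Perm H} {h : H} (hd : 1 < vertexDegree σ h) :
    σ h ≠ h := by
  intro k
  have : {x | σ.SameCycle h x} = {h} := by
    ext x
    refine ⟨fun hx => ?_, ?_⟩
    · obtain ⟨i, rfl⟩ := hx
      exact zpow_apply_eq_self_of_apply_eq_self k i
    · rintro rfl
      exact SameCycle.refl _ _
  rw [vertexDegree, this, Set.ncard_singleton] at hd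
  exact lt_irrefl _ hd

/-- The bijection is `slide a b`. The bound on `c` ensures that `b` has a companion to give away,
the bound on `p` that `a` has one to give back. -/
theorem ncard_edgeTrees_slide [Finite H] [DecidableEq ι] (a b : H) (i₀ : ι) (d : ι → ℕ) (p c : ℕ)
    (hp : 1 ≤ p) (hc : 1 ≤ c) :
    (edgeTrees a b i₀ (Function.update d i₀ (c + 1)) p).ncard =
      (edgeTrees a b i₀ (Function.update d i₀ c) (p + 1)).ncard := by
  refine Set.ncard_congr (fun t _ => (t.1, slide a b t.2.1, t.2.2)) ?_ ?_ ?_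
  · rintro ⟨α, σ, ρ⟩ ht
    have hb : σ b ≠ b := by
      refine apply_ne_self_of_one_lt_vertexDegree ?_
      have := congrFun ht.1.2.2 i₀
      dsimp only at this
      rw [← ht.2.2.1, this, Function.update_self]
      omega
    have hs : ¬ σ.SameCycle a b := by
      have := ht.2.2.2.1 i₀
      rwa [ht.2.2.1] at this
    simpa using moved_mem_edgeTrees (moves_slide hs hb) ht
  · rintro ⟨α, σ, ρ⟩ ⟨α', σ', ρ'⟩ ht ht' heq
    simp only [Prod.mk.injEq] at heq
    obtain ⟨rfl, hσ, rfl⟩ := heq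
    have key : ∀ σ, (α, σ, ρ) ∈ edgeTrees a b i₀ (Function.update d i₀ (c + 1)) p →
        ¬ σ.SameCycle a b ∧ σ b ≠ b := by
      intro σ ht
      constructor
      · have := ht.2.2.2.1 i₀
        rwa [ht.2.2.1] at this
      · refine apply_ne_self_of_one_lt_vertexDegree ?_
        have := congrFun ht.1.2.2 i₀
        dsimp only at this
        rw [← ht.2.2.1, this, Function.update_self]
        omega
    have h1 := slide_slide (key σ ht).1
    have h2 := slide_slide (key σ' ht').1
    rw [hσ, h2, inv_inj] at h1
    rw [h1]
  · rintro ⟨α, τ, ρ⟩ ht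
    have hs : ¬ τ⁻¹.SameCycle b a := fun k => by
      have := ht.2.2.2.1 i₀
      rw [ht.2.2.1] at this
      exact this (sameCycle_inv.1 k).symm
    have hb : τ⁻¹ a ≠ a := by
      refine apply_ne_self_of_one_lt_vertexDegree ?_
      have := ht.2.2.2.2
      dsimp only at this
      rw [vertexDegree_inv, this]
      omega
    have hm := (moves_slide hs hb).symm.inv
    rw [inv_inv] at hm
    refine ⟨(α, (slide b a τ⁻¹)⁻¹, ρ), ?_, ?_⟩
    · simpa using unmoved_mem_edgeTrees hm ht
    · simp only [slide_slide hs, inv_inv]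

end

/-! ### Attaching and deleting a leaf -/

section

variable {H ι : Type*} [DecidableEq H]

/-- Insert a new half-edge `some none` in front of `x`, and a new fixed point `none`. -/
def leafRotation (x : H) (σ : Perm H) : Perm (Option (Option H)) :=
  optionCongr (swap none (some x) * optionCongr σ)

/-- Add an edge with half-edges `none` and `some none`. -/
def leafInvolution (α : Perm H) : Perm (Option (Option H)) :=
  swap none (some none) * optionCongr (optionCongr α)

section

variable (x : H) (σ α : Perm H) (u v : H)

@[simp] theorem leafRotation_none : leafRotation x σ none = none := rfl

@[simp] theorem leafRotation_some_none :
    leafRotation x σ (some none) = some (some x) := by simp [leafRotation]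

theorem leafRotation_some_some : leafRotation x σ (some (some u)) =
    some (if σ u = x then none else some (σ u)) := by
  simp only [leafRotation, optionCongr_apply, Option.map_some, Perm.mul_apply]
  split_ifs with h
  · simp [h]
  · rw [swap_apply_of_ne_of_ne (by simp) (by simpa using h)]

@[simp] theorem leafInvolution_none : leafInvolution α none = some none := by
  simp [leafInvolution]

@[simp] theorem leafInvolution_some_none : leafInvolution α (some none) = none := by
  simp [leafInvolution]

@[simp] theorem leafInvolution_some_some :
    leafInvolution α (some (some u)) = some (some (α u)) := by
  simp only [leafInvolution, optionCongr_apply, Option.map_some, Perm.mul_apply]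
  rw [swap_apply_of_ne_of_ne (by simp) (by simp)]

/-- The vertex of `σ` that a half-edge of `leafRotation x σ` lies on, or `none` for the leaf. -/
def leafVertex : Option (Option H) → Option (Quotient (SameCycle.setoid σ))
  | none => none
  | some none => some (Quotient.mk _ x)
  | some (some u) => some (Quotient.mk _ u)

theorem leafRotation_sameCycle_iff (p q : Option (Option H)) :
    (leafRotation x σ).SameCycle p q ↔ leafVertex x σ p = leafVertex x σ q := by
  constructor
  · refine setoid_of_sameCycle (Setoid.ker (leafVertex x σ)) fun p => ?_
    rw [Setoid.ker_def]
    rcases p with - | - | u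
    · rfl
    · rw [leafRotation_some_none]; rfl
    · rw [leafRotation_some_some]
      have hu : (Quotient.mk (SameCycle.setoid σ) u) = Quotient.mk _ (σ u) :=
        Quotient.sound (SameCycle.refl σ u).apply_right
      split_ifs with h
      · simp only [leafVertex, hu, h]
      · simp only [leafVertex, hu]
  · have h0 : (leafRotation x σ).SameCycle (some none) (some (some x)) := by
      have := (SameCycle.refl (leafRotation x σ) (some none)).apply_right
      rwa [leafRotation_some_none] at this
    have h1 : ∀ u v, σ.SameCycle u v →
        (leafRotation x σ).SameCycle (some (some u)) (some (some v)) := by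
      intro u v
      refine setoid_of_sameCycle (Setoid.comap (fun u => some (some u))
        (SameCycle.setoid (leafRotation x σ))) fun u => ?_
      change (leafRotation x σ).SameCycle (some (some u)) (some (some (σ u)))
      have := (SameCycle.refl (leafRotation x σ) (some (some u))).apply_right
      rw [leafRotation_some_some] at this
      split_ifs at this with h
      · rw [h]; exact this.trans h0
      · exact this
    intro h
    rcases p with - | - | u <;> rcases q with - | - | v <;>
      simp only [leafVertex, Option.some.injEq, reduceCtorEq] at h
    · exact SameCycle.refl _ _
    · exact SameCycle.refl _ _
    · exact h0.trans (h1 _ _ (Quotient.exact h))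
    · exact (h1 _ _ (Quotient.exact h)).trans h0.symm
    · exact h1 _ _ (Quotient.exact h)

@[simp] theorem leafRotation_sameCycle_some_some :
    (leafRotation x σ).SameCycle (some (some u)) (some (some v)) ↔ σ.SameCycle u v := by
  rw [leafRotation_sameCycle_iff]
  simp only [leafVertex, Option.some.injEq]
  exact Quotient.eq (r := SameCycle.setoid σ)

@[simp] theorem leafRotation_sameCycle_some_none :
    (leafRotation x σ).SameCycle (some none) (some (some u)) ↔ σ.SameCycle x u := by
  rw [leafRotation_sameCycle_iff]
  simp only [leafVertex, Option.some.injEq]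
  exact Quotient.eq (r := SameCycle.setoid σ)

@[simp] theorem leafRotation_sameCycle_some_some_some_none :
    (leafRotation x σ).SameCycle (some (some u)) (some none) ↔ σ.SameCycle u x := by
  rw [sameCycle_comm, leafRotation_sameCycle_some_none, sameCycle_comm]

@[simp] theorem leafRotation_sameCycle_none (p : Option (Option H)) :
    (leafRotation x σ).SameCycle none p ↔ p = none := by
  rw [leafRotation_sameCycle_iff]
  rcases p with - | - | u <;> simp [leafVertex]

theorem card_vertices_leafRotation [Finite H] :
    Nat.card (Quotient (SameCycle.setoid (leafRotation x σ))) =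
      Nat.card (Quotient (SameCycle.setoid σ)) + 1 := by
  rw [← Finite.card_option]
  refine Nat.card_congr (Equiv.ofBijective (Quotient.lift (leafVertex x σ)
    fun p q h => (leafRotation_sameCycle_iff x σ p q).1 h) ⟨?_, ?_⟩)
  · intro p q
    induction p using Quotient.inductionOn
    induction q using Quotient.inductionOn
    exact fun k => Quotient.sound ((leafRotation_sameCycle_iff x σ _ _).2 k)
  · rintro (- | q)
    · exact ⟨⟦none⟧, rfl⟩
    · induction q using Quotient.inductionOn with
      | _ u => exact ⟨⟦some (some u)⟧, rfl⟩

theorem vertexDegree_leafRotation_none : vertexDegree (leafRotation x σ) none = 1 := by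
  simp [vertexDegree]

theorem vertexDegree_leafRotation_some_none [Finite H] :
    vertexDegree (leafRotation x σ) (some none) = vertexDegree σ x + 1 := by
  have hinj : Function.Injective (fun u : H => some (some u)) := fun u v h => by simpa using h
  unfold vertexDegree
  rw [← Set.ncard_image_of_injective _ hinj,
    ← Set.ncard_insert_of_notMem (a := some none) (by simp) (Set.toFinite _)]
  congr 1
  ext p
  rcases p with - | - | u
  · simp [sameCycle_comm (y := none)]
  · simp [SameCycle.refl]
  · simp

variable {x u} in
theorem vertexDegree_leafRotation_of_not (h : ¬ σ.SameCycle x u) :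
    vertexDegree (leafRotation x σ) (some (some u)) = vertexDegree σ u := by
  have hinj : Function.Injective (fun u : H => some (some u)) := fun u v h => by simpa using h
  unfold vertexDegree
  rw [← Set.ncard_image_of_injective _ hinj]
  congr 1
  ext p
  rcases p with - | - | v
  · simp [sameCycle_comm (y := none)]
  · simpa [sameCycle_comm (x := u)] using h
  · simp

theorem isPlaneTree_leaf_iff [Finite H] :
    IsPlaneTree (leafInvolution α) (leafRotation x σ) ↔ IsPlaneTree α σ := by
  constructor
  · intro h
    refine ⟨fun u => ?_, fun u hu => ?_, fun r h1 h2 u v => ?_, ?_⟩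
    · simpa using h.involutive (some (some u))
    · exact h.fixedPointFree (some (some u)) (by simp [hu])
    -- This retraction collapses the new edge onto `x`, so invariant relations on `H` pull back to
    -- invariant relations on the larger set.
    · let f : Option (Option H) → H := fun p => (p.getD none).getD x
      refine h.connected (r.comap f) (fun p => ?_) (fun p => ?_) (some (some u)) (some (some v)) <;>
        rw [Setoid.comap_rel]
      · rcases p with - | - | u
        · simp [f]
        · simp [f]
        · simpa [f] using h1 u
      · rcases p with - | - | u
        · simp [f]
        · simp [f]
        · rw [leafRotation_some_some]
          split_ifs with hu
          · simpa [f, hu] using h2 u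
          · simpa [f] using h2 u
    · have := h.card_vertices
      rw [card_vertices_leafRotation, Finite.card_option, Finite.card_option] at this
      omega
  · intro h
    refine ⟨fun p => ?_, fun p => ?_, fun r h1 h2 => ?_, ?_⟩
    · rcases p with - | - | u <;> simp [h.involutive]
    · rcases p with - | - | u <;> simp [h.fixedPointFree]
    · have hσ : ∀ p q, (leafRotation x σ).SameCycle p q → r p q := fun p q =>
        setoid_of_sameCycle r h2
      have hr := h.connected (r.comap fun u => some (some u))
        (fun u => by simpa [Setoid.comap_rel] using h1 (some (some u)))
        (fun u => hσ _ _ (by simp [SameCycle.refl]))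
      have hb : r (some none) (some (some x)) := hσ _ _ (by simp [SameCycle.refl])
      have ha : r none (some none) := by simpa using h1 none
      have key : ∀ p, r p (some (some x)) := by
        rintro (- | - | u)
        exacts [r.trans ha hb, hb, hr _ _]
      exact fun p q => r.trans (key p) (r.symm (key q))
    · rw [card_vertices_leafRotation, Finite.card_option, Finite.card_option]
      have := h.card_vertices
      omega

end

variable [DecidableEq ι]

/-- Attach a new leaf `none` in front of the root `i₀`, which moves to the new edge. -/
def addLeaf (i₀ : ι) (t : Perm H × Perm H × (ι → H)) :
    Perm (Option (Option H)) × Perm (Option (Option H)) × (ι → Option (Option H)) :=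
  (leafInvolution t.1, leafRotation (t.2.2 i₀) t.2.1,
    Function.update (fun j => some (some (t.2.2 j))) i₀ (some none))

theorem addLeaf_mem_iff [Finite H] (i₀ : ι) (d : ι → ℕ) (D : ℕ) (t : Perm H × Perm H × (ι → H)) :
    addLeaf i₀ t ∈ edgeTrees none (some none) i₀ (Function.update d i₀ (D + 1)) 1 ↔
      t ∈ rootedTrees ι H fun δ => δ = Function.update d i₀ D := by
  obtain ⟨α, σ, ρ⟩ := t
  have hnone : ∀ j, ¬ (leafRotation (ρ i₀) σ).SameCycle none
      (Function.update (fun j => some (some (ρ j))) i₀ (some none) j) := by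
    intro j
    by_cases hj : j = i₀
    · subst hj; simp
    · simp [hj]
  simp only [edgeTrees, rootedTrees, addLeaf, Set.mem_ofPred_eq, isPlaneTree_leaf_iff,
    leafInvolution_none, Function.update_self, hnone, vertexDegree_leafRotation_none,
    not_false_eq_true, implies_true, and_true]
  refine and_congr_right fun _ => ?_
  have hdist : (∀ i j, (leafRotation (ρ i₀) σ).SameCycle
      (Function.update (fun j => some (some (ρ j))) i₀ (some none) i)
      (Function.update (fun j => some (some (ρ j))) i₀ (some none) j) → i = j) ↔
      ∀ i j, σ.SameCycle (ρ i) (ρ j) → i = j := by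
    refine forall_congr' fun i => forall_congr' fun j => ?_
    by_cases hi : i = i₀ <;> by_cases hj : j = i₀
    · simp [hi, hj]
    · subst hi; simp [hj]
    · subst hj; simp [hi]
    · simp [hi, hj]
  rw [hdist]
  refine and_congr_right fun hd => ?_
  rw [funext_iff, funext_iff]
  refine forall_congr' fun j => ?_
  by_cases hj : j = i₀
  · subst hj
    simp [vertexDegree_leafRotation_some_none]
  · rw [Function.update_of_ne hj, Function.update_of_ne hj, Function.update_of_ne hj,
      vertexDegree_leafRotation_of_not _ fun k => hj (hd _ _ k).symm]

omit [DecidableEq H] in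
theorem apply_eq_self_of_vertexDegree_eq_one {σ : Perm H} {h : H} (hh : vertexDegree σ h = 1) :
    σ h = h := by
  obtain ⟨y, hy⟩ := Set.ncard_eq_one.1 hh
  have e1 : h ∈ {x | σ.SameCycle h x} := SameCycle.refl _ _
  have e2 : σ h ∈ {x | σ.SameCycle h x} := (SameCycle.refl σ h).apply_right
  rw [hy] at e1 e2
  rw [e2, e1]

theorem exists_optionCongr_eq {σ : Perm (Option H)} (h : σ none = none) :
    ∃ τ : Perm H, σ = optionCongr τ := by
  refine ⟨removeNone σ, ?_⟩
  have := decomposeOption.symm_apply_apply σ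
  rw [← this]
  simp only [decomposeOption_apply, decomposeOption_symm_apply, h, swap_self]
  rfl

theorem addLeaf_injective (i₀ : ι) : Function.Injective (addLeaf (H := H) i₀) := by
  rintro ⟨α, σ, ρ⟩ ⟨α', σ', ρ'⟩ h
  simp only [addLeaf, Prod.mk.injEq] at h
  obtain ⟨h1, h2, h3⟩ := h
  -- The old root can be recovered as the successor of the new one.
  have hx : ρ i₀ = ρ' i₀ := by
    have := congrArg (fun f : Perm _ => f (some none)) h2
    simpa using this
  rw [hx] at h2
  have e1 : α = α' := optionCongr_injective (optionCongr_injective (mul_left_cancel h1))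
  have e2 : σ = σ' := optionCongr_injective (mul_left_cancel (optionCongr_injective h2))
  have e3 : ρ = ρ' := by
    ext j
    by_cases hj : j = i₀
    · rw [hj, hx]
    · have := congrFun h3 j
      simpa [hj] using this
  rw [e1, e2, e3]

/-- A half-edge of degree 1 is fixed by the rotation and can be deleted together with its opposite
`b`; as `b` has degree at least 2, its successor survives and inherits the root. -/
theorem ncard_edgeTrees_leaf [Finite H] (i₀ : ι) (d : ι → ℕ) (D : ℕ) (hD : 1 ≤ D) :
    (edgeTrees (none : Option (Option H)) (some none) i₀ (Function.update d i₀ (D + 1)) 1).ncard =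
      (rootedTrees ι H fun δ => δ = Function.update d i₀ D).ncard := by
  symm
  refine Set.ncard_congr (fun t _ => addLeaf i₀ t) (fun t ht => (addLeaf_mem_iff i₀ d D t).2 ht)
    (fun t t' _ _ h => addLeaf_injective i₀ h) ?_
  rintro ⟨α, σ, ρ⟩ ht
  suffices h : ∃ t, addLeaf i₀ t = (α, σ, ρ) by
    obtain ⟨t, h⟩ := h
    exact ⟨t, (addLeaf_mem_iff i₀ d D t).1 (h ▸ ht), h⟩
  obtain ⟨⟨h1, h2, h3⟩, h4, h5, h6, h7⟩ := ht
  dsimp only at h1 h2 h3 h4 h5 h6 h7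
  -- At `j = i₀` the value is a dummy, overwritten later; it only requires `H` to be nonempty.
  have hρ : ∀ j, ∃ u, j ≠ i₀ → ρ j = some (some u) := by
    intro j
    have e1 : ρ j ≠ none := fun k => h6 j (by rw [k])
    have e2 : j ≠ i₀ → ρ j ≠ some none := fun hj k => hj (h2 _ _ (by rw [k, h5]))
    have hne : Nonempty H := by
      by_contra hH
      rw [not_nonempty_iff] at hH
      have : σ (some none) ≠ some none := apply_ne_self_of_one_lt_vertexDegree (by
        have := congrFun h3 i₀
        rw [Function.update_self, h5] at this
        omega)
      have h8 := h6 i₀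
      rw [h5] at h8
      have h9 : σ (some none) = none := by
        rcases hh : σ (some none) with - | - | u
        · rfl
        · exact absurd hh this
        · exact hH.elim u
      exact h8 (by rw [← h9]; simp [SameCycle.refl])
    rcases hh : ρ j with - | - | u
    · exact absurd hh e1
    · exact ⟨Classical.arbitrary H, fun hj => absurd hh (e2 hj)⟩
    · exact ⟨u, fun _ => rfl⟩
  choose ρ' hρ' using hρ
  obtain ⟨σ₁, rfl⟩ : ∃ τ, σ = optionCongr τ :=
    exists_optionCongr_eq (apply_eq_self_of_vertexDegree_eq_one h7)
  obtain ⟨x, hx⟩ : ∃ x, σ₁ none = some x := by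
    have : optionCongr σ₁ (some none) ≠ some none := apply_ne_self_of_one_lt_vertexDegree (by
      have := congrFun h3 i₀
      rw [Function.update_self, h5] at this
      omega)
    exact Option.ne_none_iff_exists'.1 fun k => this (by simp [k])
  -- The transposition takes `b` out of its cycle, leaving a fixed point that can be removed.
  obtain ⟨σ', hσ'⟩ : ∃ τ, swap none (some x) * σ₁ = optionCongr τ :=
    exists_optionCongr_eq (by simp [hx])
  obtain ⟨α₁, hα₁⟩ : ∃ τ, swap none (some none) * α = optionCongr τ :=
    exists_optionCongr_eq (by simp [h4])
  obtain ⟨α', rfl⟩ : ∃ τ, α₁ = optionCongr τ := by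
    refine exists_optionCongr_eq ?_
    have h8 : α (some none) = none := by rw [← h4, h1.involutive]
    have := congrArg (fun f : Perm _ => f (some none)) hα₁
    simpa [h8] using this.symm
  refine ⟨(α', σ', Function.update ρ' i₀ x), ?_⟩
  simp only [addLeaf, leafInvolution, leafRotation, Function.update_self, ← hα₁, ← hσ',
    swap_mul_self_mul, Prod.mk.injEq, true_and]
  ext1 j
  by_cases hj : j = i₀
  · rw [hj, Function.update_self, h5]
  · rw [Function.update_of_ne hj, Function.update_of_ne hj, hρ' j hj]

/-- Contracting the distinguished edge. -/
theorem ncard_edgeTrees [Finite H] [Nonempty H] [Finite ι] (i₀ : ι) (d : ι → ℕ) (p : ℕ) (hp : 1 ≤ p)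
    (hd : 1 ≤ d i₀) :
    (edgeTrees (none : Option (Option H)) (some none) i₀ d p).ncard =
      (rootedTrees ι H fun δ => δ = Function.update d i₀ (d i₀ + p - 2)).ncard := by
  have key : ∀ p c, 1 ≤ c →
      (edgeTrees (none : Option (Option H)) (some none) i₀ (Function.update d i₀ c) (p + 1)).ncard =
      (rootedTrees ι H fun δ => δ = Function.update d i₀ (c + p - 1)).ncard := by
    intro p
    induction p with
    | zero =>
      intro c hc
      -- For `c = 1` both ends would be leaves and the edge a whole component, impossible as `H` is
      -- nonempty; on the other side a root would have degree 0.
      obtain rfl | hc := hc.eq_or_lt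
      · have e1 : (rootedTrees ι H fun δ => δ = Function.update d i₀ (1 + 0 - 1)) = ∅ := by
          rw [Set.eq_empty_iff_forall_notMem]
          rintro t ⟨-, -, h⟩
          have := congrFun h i₀
          rw [Function.update_self] at this
          exact (vertexDegree_pos _ _).ne' this
        rw [e1, Set.ncard_empty, Set.ncard_eq_zero (Set.toFinite _),
          Set.eq_empty_iff_forall_notMem]
        rintro ⟨α, σ, ρ⟩ ⟨⟨h1, h2, h3⟩, h4, h5, h6, h7⟩
        dsimp only at h1 h2 h3 h4 h5 h6 h7
        have ha := apply_eq_self_of_vertexDegree_eq_one h7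
        have hb := apply_eq_self_of_vertexDegree_eq_one (h := some none) (by
          have := congrFun h3 i₀
          rwa [h5, Function.update_self] at this)
        have hα : α (some none) = none := by rw [← h4, h1.involutive]
        have := h1.connected (Setoid.ker fun p => p = none ∨ p = some none) (fun p => ?_)
          (fun p => ?_) none (some (some (Classical.arbitrary H)))
        · simp [Setoid.ker_def] at this
        · rw [Setoid.ker_def, eq_iff_iff]
          have e1 : α p = none ↔ p = some none := by rw [← hα, α.apply_eq_iff_eq]
          have e2 : α p = some none ↔ p = none := by rw [← h4, α.apply_eq_iff_eq]
          rw [e1, e2, or_comm]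
        · rw [Setoid.ker_def, eq_iff_iff]
          have e1 : σ p = none ↔ p = none :=
            ⟨fun k => σ.injective (k.trans ha.symm), fun k => by rw [k, ha]⟩
          have e2 : σ p = some none ↔ p = some none :=
            ⟨fun k => σ.injective (k.trans hb.symm), fun k => by rw [k, hb]⟩
          rw [e1, e2]
      · obtain ⟨D, rfl⟩ : ∃ D, c = D + 1 := ⟨c - 1, by omega⟩
        rw [zero_add, ncard_edgeTrees_leaf i₀ d D (by omega)]
        rfl
    | succ p ih =>
      intro c hc
      rw [← ncard_edgeTrees_slide _ _ _ _ (p + 1) _ (by omega) hc, ih (c + 1) (by omega),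
        show c + 1 + p - 1 = c + (p + 1) - 1 by omega]
  have := key (p - 1) (d i₀) hd
  rw [Function.update_eq_self, Nat.sub_add_cancel hp] at this
  rw [this, show d i₀ + (p - 1) - 1 = d i₀ + p - 2 by omega]

end

/-! ### Classification by the vertex opposite to the last root -/

section

variable {H ι : Type*}

/-- Rooted plane trees with an additional half-edge `a` of degree `p`, opposite to `b`, whose
vertex is none of the root vertices. -/
def pointedTrees (a b : H) (d : ι → ℕ) (p : ℕ) : Set (Perm H × Perm H × (ι → H)) :=
  {t | t ∈ rootedTrees ι H (fun δ => δ = d) ∧ t.1 a = b ∧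
    (∀ j, ¬ t.2.1.SameCycle a (t.2.2 j)) ∧ vertexDegree t.2.1 a = p}

theorem mem_edgeTrees_iff {a b : H} {i : ι} {d : ι → ℕ} {p : ℕ} {t : Perm H × Perm H × (ι → H)} :
    t ∈ edgeTrees a b i d p ↔ t ∈ pointedTrees a b d p ∧ t.2.2 i = b := by
  simp only [edgeTrees, pointedTrees, Set.mem_ofPred_eq]
  tauto

theorem snoc_mem_rootedTrees_iff {n : ℕ} {d : Fin n → ℕ} {p : ℕ} {α σ : Perm H} {ρ : Fin n → H}
    {a : H} :
    (α, σ, (Fin.snoc ρ a : Fin (n + 1) → H)) ∈ rootedTrees (Fin (n + 1)) H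
        (fun δ => δ = (Fin.snoc d p : Fin (n + 1) → ℕ)) ↔
      (α, σ, ρ) ∈ rootedTrees (Fin n) H (fun δ => δ = d) ∧ (∀ j, ¬ σ.SameCycle a (ρ j)) ∧
        vertexDegree σ a = p := by
  simp only [rootedTrees, Set.mem_ofPred_eq, and_assoc]
  refine and_congr_right fun _ => ?_
  simp only [funext_iff, Fin.forall_fin_succ', Fin.snoc_castSucc, Fin.snoc_last,
    SameCycle.refl, true_imp_iff, Fin.castSucc_inj, Fin.castSucc_ne_last,
    (Fin.castSucc_ne_last _).symm, imp_false, sameCycle_comm (y := a)]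
  simp only [forall_and]
  tauto

theorem ncard_rooted_eq_pointed {n : ℕ} (a b : H) (d : Fin n → ℕ) (p : ℕ) :
    {t ∈ rootedTrees (Fin (n + 1)) H (fun δ => δ = (Fin.snoc d p : Fin (n + 1) → ℕ)) |
      t.2.2 (Fin.last n) = a ∧ t.1 a = b}.ncard = (pointedTrees a b d p).ncard := by
  symm
  refine Set.ncard_congr (fun t _ => (t.1, t.2.1, (Fin.snoc t.2.2 a : Fin (n + 1) → H))) ?_ ?_ ?_
  · rintro ⟨α, σ, ρ⟩ ⟨h1, h2, h3⟩
    exact ⟨snoc_mem_rootedTrees_iff.2 ⟨h1, h3⟩, by simp, h2⟩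
  · rintro ⟨α, σ, ρ⟩ ⟨α', σ', ρ'⟩ _ _ h
    simp only [Prod.mk.injEq] at h
    obtain ⟨rfl, rfl, h⟩ := h
    rw [(Fin.snoc_injective2 h).1]
  · rintro ⟨α, σ, ρ⟩ ⟨h1, h2, h3⟩
    dsimp only at h2 h3
    rw [← Fin.snoc_init_self ρ, h2] at h1
    refine ⟨(α, σ, Fin.init ρ), ⟨(snoc_mem_rootedTrees_iff.1 h1).1, h3,
      (snoc_mem_rootedTrees_iff.1 h1).2⟩, ?_⟩
    simp [← h2]

/-- The root at the vertex of `b` can be any of its half-edges. -/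
theorem ncard_pointed_sameCycle [Finite H] [Finite ι] [DecidableEq ι] (a b : H) (d : ι → ℕ) (p : ℕ)
    (i : ι) :
    {t ∈ pointedTrees a b d p | t.2.1.SameCycle b (t.2.2 i)}.ncard =
      d i * (edgeTrees a b i d p).ncard := by
  classical
  have := Fintype.ofFinite H
  have := Fintype.ofFinite ι
  set S := {t ∈ pointedTrees a b d p | t.2.1.SameCycle b (t.2.2 i)} with hS
  have hmem : ∀ (α σ : Perm H) (ρ : ι → H) (u v : H), σ.SameCycle b u → σ.SameCycle b v →
      (α, σ, Function.update ρ i u) ∈ pointedTrees a b d p →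
      (α, σ, Function.update ρ i v) ∈ pointedTrees a b d p := by
    rintro α σ ρ u v hu hv ⟨⟨h1, h2, h3⟩, h4, h5, h6⟩
    dsimp only at h1 h2 h3 h4 h5 h6
    have key : ∀ j, σ.SameCycle (Function.update ρ i u j) (Function.update ρ i v j) := by
      intro j
      by_cases hj : j = i
      · subst hj
        simpa using hu.symm.trans hv
      · simp [hj, SameCycle.refl]
    refine ⟨⟨h1, fun j k hjk => h2 j k (((key j).trans hjk).trans (key k).symm), ?_⟩, h4,
      fun j hj => h5 j (hj.trans (key j).symm), h6⟩
    rw [← h3]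
    ext j
    exact (vertexDegree_congr (key j)).symm
  -- Moving the `i`-th root to `b` forgets its position on the cycle of `b`, so each fibre has `d i`
  -- elements.
  let f : (Perm H × Perm H × (ι → H)) → (Perm H × Perm H × (ι → H)) := fun t =>
    (t.1, t.2.1, Function.update t.2.2 i b)
  have hmaps : Set.MapsTo f (S.toFinset : Set _) ((edgeTrees a b i d p).toFinset : Set _) := by
    rintro ⟨α, σ, ρ⟩ ht
    rw [Set.coe_toFinset] at ht ⊢
    refine mem_edgeTrees_iff.2 ⟨hmem α σ ρ (ρ i) b ht.2 (SameCycle.refl _ _) ?_, by simp [f]⟩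
    rw [Function.update_eq_self]
    exact ht.1
  rw [Set.ncard_eq_toFinset_card', Finset.card_eq_sum_card_fiberwise hmaps,
    Set.ncard_eq_toFinset_card', mul_comm, ← smul_eq_mul, ← Finset.sum_const]
  refine Finset.sum_congr rfl fun t ht => ?_
  rw [Set.mem_toFinset, mem_edgeTrees_iff] at ht
  obtain ⟨α, σ, ρ⟩ := t
  obtain ⟨ht, hb⟩ := ht
  dsimp only at hb
  rw [← congrFun ht.1.2.2 i, ← Set.ncard_coe_finset]
  symm
  refine Set.ncard_congr (fun h _ => (α, σ, Function.update ρ i h)) ?_ ?_ ?_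
  · intro h hh
    dsimp only at hh
    rw [hb] at hh
    have h1 : (α, σ, Function.update ρ i h) ∈ S := by
      refine ⟨hmem α σ ρ b h (SameCycle.refl _ _) hh ?_, by simpa using hh⟩
      rwa [show Function.update ρ i b = ρ by rw [← hb, Function.update_eq_self]]
    simp [h1, f, ← hb]
  · intro h h' _ _ heq
    simp only [Prod.mk.injEq, true_and] at heq
    simpa using congrFun heq i
  · rintro ⟨α', σ', ρ'⟩ ht'
    simp only [Finset.coe_filter, Set.mem_toFinset, Set.mem_ofPred_eq, f, Prod.mk.injEq] at ht'
    obtain ⟨h1, rfl, rfl, h2⟩ := ht'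
    refine ⟨ρ' i, ?_, ?_⟩
    · have := h1.2
      dsimp only at this ⊢
      rwa [← hb] at this
    · simp [← h2]

/-- Here `b` is adopted as a further root. Its degree `c + 1` lies between 1 and the number of
half-edges, so `c` ranges below `M`. -/
theorem ncard_pointed_not_sameCycle [Finite H] {n : ℕ} (a b : H) (d : Fin n → ℕ) (p M : ℕ)
    (hM : Nat.card H ≤ M) :
    {t ∈ pointedTrees a b d p | ∀ i, ¬ t.2.1.SameCycle b (t.2.2 i)}.ncard =
      ∑ c ∈ Finset.range M,
        (edgeTrees a b (Fin.last n) (Fin.snoc d (c + 1) : Fin (n + 1) → ℕ) p).ncard := by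
  classical
  have := Fintype.ofFinite H
  set S := {t ∈ pointedTrees a b d p | ∀ i, ¬ t.2.1.SameCycle b (t.2.2 i)} with hS
  have hmaps : Set.MapsTo (fun t : Perm H × Perm H × (Fin n → H) => vertexDegree t.2.1 b - 1)
      (S.toFinset : Set _) (Finset.range M : Set ℕ) := by
    intro t _
    have h1 := vertexDegree_le t.2.1 b
    have h2 := vertexDegree_pos t.2.1 b
    simp only [Finset.coe_range, Set.mem_Iio]
    omega
  rw [Set.ncard_eq_toFinset_card', Finset.card_eq_sum_card_fiberwise hmaps]
  refine Finset.sum_congr rfl fun c _ => ?_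
  rw [← Set.ncard_coe_finset]
  refine Set.ncard_congr (fun t _ => (t.1, t.2.1, (Fin.snoc t.2.2 b : Fin (n + 1) → H))) ?_ ?_ ?_
  · rintro ⟨α, σ, ρ⟩ ht
    simp only [Finset.coe_filter, Set.mem_toFinset, Set.mem_ofPred_eq] at ht
    obtain ⟨⟨⟨h1, h2, h3, h4⟩, h5⟩, h6⟩ := ht
    dsimp only at h1 h2 h3 h4 h5
    have h7 : vertexDegree σ b = c + 1 := by
      have := vertexDegree_pos σ b
      change vertexDegree σ b - 1 = c at h6
      omega
    refine mem_edgeTrees_iff.2 ⟨⟨snoc_mem_rootedTrees_iff.2 ⟨h1, h5, h7⟩, h2, ?_, h4⟩,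
      by simp⟩
    refine fun j => Fin.lastCases ?_ (fun j => ?_) j
    -- The new root vertex differs from that of `a` because there are no loops.
    · have := h1.1.not_sameCycle a
      dsimp only at this
      rw [h2] at this
      simpa using this
    · simpa using h3 j
  · rintro ⟨α, σ, ρ⟩ ⟨α', σ', ρ'⟩ _ _ h
    simp only [Prod.mk.injEq] at h
    obtain ⟨rfl, rfl, h⟩ := h
    rw [(Fin.snoc_injective2 h).1]
  · rintro ⟨α, σ, ρ⟩ ht
    obtain ⟨⟨h1, h2, h3, h4⟩, h5⟩ := mem_edgeTrees_iff.1 ht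
    dsimp only at h2 h3 h4 h5
    rw [← Fin.snoc_init_self ρ, h5] at h1
    obtain ⟨h1, h6, h7⟩ := snoc_mem_rootedTrees_iff.1 h1
    refine ⟨(α, σ, Fin.init ρ), ?_, by simp [← h5]⟩
    simp only [Finset.coe_filter, Set.mem_toFinset, Set.mem_ofPred_eq]
    exact ⟨⟨⟨h1, h2, fun j => h3 j.castSucc, h4⟩, h6⟩, by omega⟩

/-- Classification of pointed trees by the vertex of `b`. -/
theorem ncard_pointedTrees [Finite H] {n : ℕ} (a b : H) (d : Fin n → ℕ) (p M : ℕ)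
    (hM : Nat.card H ≤ M) :
    (pointedTrees a b d p).ncard = ∑ i, d i * (edgeTrees a b i d p).ncard +
      ∑ c ∈ Finset.range M,
        (edgeTrees a b (Fin.last n) (Fin.snoc d (c + 1) : Fin (n + 1) → ℕ) p).ncard := by
  rw [← ncard_pointed_not_sameCycle a b d p M hM,
    ← Finset.sum_congr rfl fun i _ => ncard_pointed_sameCycle a b d p i]
  have hunion : pointedTrees a b d p =
      (⋃ i, {t ∈ pointedTrees a b d p | t.2.1.SameCycle b (t.2.2 i)}) ∪
        {t ∈ pointedTrees a b d p | ∀ i, ¬ t.2.1.SameCycle b (t.2.2 i)} := by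
    ext t
    simp only [Set.mem_union, Set.mem_iUnion, Set.mem_ofPred_eq]
    by_cases h : ∃ i, t.2.1.SameCycle b (t.2.2 i)
    · obtain ⟨i, hi⟩ := h
      exact ⟨fun ht => Or.inl ⟨i, ht, hi⟩, fun ht => ht.elim (fun ⟨_, k⟩ => k.1) fun k => k.1⟩
    · rw [not_exists] at h
      exact ⟨fun ht => Or.inr ⟨ht, h⟩, fun ht => ht.elim (fun ⟨_, k⟩ => k.1) fun k => k.1⟩
  have hdisj : Disjoint (⋃ i, {t ∈ pointedTrees a b d p | t.2.1.SameCycle b (t.2.2 i)})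
      {t ∈ pointedTrees a b d p | ∀ i, ¬ t.2.1.SameCycle b (t.2.2 i)} := by
    rw [Set.disjoint_left]
    intro t ht ht'
    obtain ⟨i, hi⟩ := Set.mem_iUnion.1 ht
    exact ht'.2 i hi.2
  conv_lhs => rw [hunion]
  rw [Set.ncard_union_eq hdisj (Set.toFinite _) (Set.toFinite _),
    Set.ncard_iUnion_of_finite (fun _ => Set.toFinite _), finsum_eq_sum_of_fintype]
  intro i j hij
  rw [Function.onFun, Set.disjoint_left]
  intro t ht ht'
  exact hij (ht.1.1.2.1 i j (ht.2.symm.trans ht'.2))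

/-! ### From labelled counts to the recurrence -/

theorem ncard_rootedTrees_eq_T_mul_of_card_eq {N e : ℕ} [Finite H] (hH : Nat.card H = 2 * e)
    (d : Fin N → ℕ) (hN : 0 < N) (he : e ≠ 0) :
    (rootedTrees (Fin N) H fun δ => δ = d).ncard = T N e le_rfl d * (2 * e).factorial := by
  rw [← ncard_rootedTrees_eq_T_mul le_rfl d hN he,
    ncard_rootedTrees_congr ((Finite.equivFin H).trans (finCongr hH))]
  simp only [Fin.castLE_rfl, id_eq, funext_iff]

/-- Pinning the last root and its opposite to two given labels divides `(2m + 2)!` by `(2m + 2)(2m +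
1)`. -/
theorem T_mul_factorial (n m : ℕ) (d : Fin n → ℕ) (p : ℕ) :
    T (n + 1) (m + 1) le_rfl (Fin.snoc d p : Fin (n + 1) → ℕ) * (2 * m).factorial =
      ∑ i, d i * (edgeTrees (none : Option (Option (Fin (2 * m)))) (some none) i d p).ncard +
      ∑ c ∈ Finset.range (2 * m + 2),
        (edgeTrees (none : Option (Option (Fin (2 * m)))) (some none) (Fin.last n)
          (Fin.snoc d (c + 1) : Fin (n + 1) → ℕ) p).ncard := by
  have hcard : Nat.card (Option (Option (Fin (2 * m)))) = 2 * (m + 1) := by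
    rw [Finite.card_option, Finite.card_option, Nat.card_fin]
    ring
  rw [← ncard_pointedTrees _ _ _ _ _ (by omega), ← ncard_rooted_eq_pointed]
  have h1 := ncard_rootedTrees_eq_T_mul_of_card_eq hcard (Fin.snoc d p : Fin (n + 1) → ℕ)
    n.succ_pos m.succ_ne_zero
  rw [ncard_rootedTrees_eq_mul _ (Fin.last n) (a := none) (b := some none) (by simp), hcard,
    show (2 * (m + 1)).factorial = (2 * (m + 1)) * (2 * (m + 1) - 1) * (2 * m).factorial by
      rw [show 2 * (m + 1) = 2 * m + 1 + 1 by ring, Nat.factorial_succ, Nat.factorial_succ]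
      simp [mul_assoc]] at h1
  have h2 : 0 < (2 * (m + 1)) * (2 * (m + 1) - 1) := Nat.mul_pos (by omega) (by omega)
  refine Nat.eq_of_mul_eq_mul_left h2 ?_
  rw [h1]
  ring

theorem T_snoc_eq_zero {N n e : ℕ} (hk : n + 1 ≤ N) (he : e ≠ 0) (d : Fin n → ℕ) (D : ℕ)
    (hD : D = 0 ∨ 2 * e < D) : T N e hk (Fin.snoc d D : Fin (n + 1) → ℕ) = 0 := by
  have h := ncard_rootedTrees_eq_T_mul hk (Fin.snoc d D : Fin (n + 1) → ℕ) (by omega) he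
  rw [(Set.eq_empty_iff_forall_notMem (s := rootedTrees _ _ _)).2, Set.ncard_empty] at h
  · exact (Nat.mul_eq_zero.1 h.symm).resolve_right (Nat.factorial_ne_zero _)
  · rintro t ⟨-, -, ht⟩
    have := ht (Fin.last n)
    rw [Fin.snoc_last] at this
    dsimp only at this
    have h1 := vertexDegree_pos t.2.1 (t.2.2 (Fin.castLE hk (Fin.last n)))
    have h2 := vertexDegree_le t.2.1 (t.2.2 (Fin.castLE hk (Fin.last n)))
    rw [Nat.card_fin] at h2
    omega

/-- Summation over the degree of the last root. -/
theorem T_eq_sum {n e : ℕ} (he : e ≠ 0) (d : Fin n → ℕ) (K : ℕ) (hK : 2 * e < K) :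
    T (n + 1) e (Nat.le_succ n) d =
      ∑ D ∈ Finset.range K, T (n + 1) e le_rfl (Fin.snoc d D : Fin (n + 1) → ℕ) := by
  classical
  refine Nat.eq_of_mul_eq_mul_right (Nat.factorial_pos (2 * e)) ?_
  rw [Finset.sum_mul, ← ncard_rootedTrees_eq_T_mul _ _ n.succ_pos he]
  set S := rootedTrees (Fin (n + 1)) (Fin (2 * e)) _
  have hmaps : Set.MapsTo (fun t : Perm (Fin (2 * e)) × Perm (Fin (2 * e)) ×
      (Fin (n + 1) → Fin (2 * e)) => vertexDegree t.2.1 (t.2.2 (Fin.last n)))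
      (S.toFinset : Set _) (Finset.range K : Set ℕ) := by
    intro t _
    have h1 := vertexDegree_le t.2.1 (t.2.2 (Fin.last n))
    rw [Nat.card_fin] at h1
    simp only [Finset.coe_range, Set.mem_Iio]
    omega
  rw [Set.ncard_eq_toFinset_card', Finset.card_eq_sum_card_fiberwise hmaps]
  refine Finset.sum_congr rfl fun D _ => ?_
  rw [← ncard_rootedTrees_eq_T_mul _ _ n.succ_pos he, ← Set.ncard_coe_finset]
  congr 1
  ext t
  simp only [Finset.coe_filter, Set.mem_toFinset, Set.mem_ofPred_eq, S, rootedTrees, and_assoc]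
  refine and_congr_right fun _ => and_congr_right fun _ => ?_
  rw [Fin.forall_fin_succ', Fin.snoc_last]
  simp only [Fin.snoc_castSucc]
  rfl

/-- The shifted index runs through `p - 1, p, …`; the second sum supplies `1, …, p - 2`, and the
index 0 contributes nothing. -/
theorem sum_shift_add_sum_Icc (f : ℕ → ℕ) (h0 : f 0 = 0) (p M : ℕ) (hp : 1 ≤ p) :
    ∑ c ∈ Finset.range M, f (c + 1 + p - 2) + ∑ j ∈ Finset.Icc 1 (p - 2), f j =
      ∑ D ∈ Finset.range (p - 1 + M), f D := by
  rw [Finset.sum_range_add, add_comm]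
  congr 1
  · obtain rfl | hp := hp.eq_or_lt
    · rfl
    · obtain ⟨k, rfl⟩ : ∃ k, p = k + 2 := ⟨p - 2, by omega⟩
      rw [show k + 2 - 1 = k + 1 by omega, Finset.sum_range_succ', h0, add_zero,
        Nat.add_sub_cancel, Finset.range_eq_Ico, Finset.sum_Ico_add' f 0 k 1, zero_add]
      rfl
  · exact Finset.sum_congr rfl fun c _ => by rw [show c + 1 + p - 2 = p - 1 + c by omega]

theorem T_recurrence (n m : ℕ) (hm : m ≠ 0) (d : Fin n → ℕ) (p : ℕ) (hp : 1 ≤ p) :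
    T (n + 1) (m + 1) le_rfl (Fin.snoc d p : Fin (n + 1) → ℕ) +
        ∑ j ∈ Finset.Icc 1 (p - 2), T (n + 1) m le_rfl (Fin.snoc d j : Fin (n + 1) → ℕ) =
      ∑ i : Fin n, d i * T n m le_rfl (Function.update d i (d i + p - 2)) +
        T (n + 1) m (Nat.le_succ n) d := by
  have hne : Nonempty (Fin (2 * m)) := ⟨⟨0, by omega⟩⟩
  have hcard : Nat.card (Fin (2 * m)) = 2 * m := Nat.card_fin _
  have key : T (n + 1) (m + 1) le_rfl (Fin.snoc d p : Fin (n + 1) → ℕ) =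
      ∑ i : Fin n, d i * T n m le_rfl (Function.update d i (d i + p - 2)) +
      ∑ c ∈ Finset.range (2 * m + 2),
        T (n + 1) m le_rfl (Fin.snoc d (c + 1 + p - 2) : Fin (n + 1) → ℕ) := by
    refine Nat.eq_of_mul_eq_mul_right (Nat.factorial_pos (2 * m)) ?_
    rw [T_mul_factorial, add_mul, Finset.sum_mul, Finset.sum_mul]
    congr 1
    · refine Finset.sum_congr rfl fun i _ => ?_
      -- If `d i = 0`, the subtraction in `d i + p - 2` may be truncated, but the factor `d i` kills
      -- the term.
      obtain hi | hi := Nat.eq_zero_or_pos (d i)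
      · simp [hi]
      · rw [ncard_edgeTrees i d p hp hi, mul_assoc,
          ncard_rootedTrees_eq_T_mul_of_card_eq hcard _ i.pos hm]
    · refine Finset.sum_congr rfl fun c _ => ?_
      rw [ncard_edgeTrees (Fin.last n) _ p hp (by simp), Fin.snoc_last, Fin.update_snoc_last,
        ncard_rootedTrees_eq_T_mul_of_card_eq hcard _ n.succ_pos hm]
  rw [key, add_assoc, sum_shift_add_sum_Icc
    (fun D => T (n + 1) m le_rfl (Fin.snoc d D : Fin (n + 1) → ℕ))
    (T_snoc_eq_zero _ hm _ _ (Or.inl rfl)) _ _ hp, T_eq_sum hm d (p - 1 + (2 * m + 2)) (by omega)]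

/-! ### The case of a single edge -/

theorem isPlaneTree_single_edge :
    IsPlaneTree (swap none (some none) : Perm (Option (Option (Fin 0)))) 1 where
  involutive := by decide
  fixedPointFree := by decide
  connected r h1 _ := by
    have h2 : r none (some none) := by simpa using h1 none
    rintro (- | - | u) (- | - | v)
    · exact r.refl _
    · exact h2
    · exact v.elim0
    · exact r.symm h2
    · exact r.refl _
    · exact v.elim0
    all_goals exact u.elim0
  card_vertices := by
    have : Nat.card (Quotient (SameCycle.setoid (1 : Perm (Option (Option (Fin 0)))))) =
        Nat.card (Option (Option (Fin 0))) := by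
      refine (Nat.card_congr (Equiv.ofBijective (Quotient.mk _) ⟨fun u v h => ?_,
        Quotient.mk_surjective⟩)).symm
      exact sameCycle_one.1 (Quotient.exact h)
    rw [this, Finite.card_option, Finite.card_option, Nat.card_fin]

theorem vertexDegree_one (h : H) : vertexDegree (1 : Perm H) h = 1 := by
  simp [vertexDegree]

/-- With only two half-edges at distinct vertices the rotation is trivial, and every root must be
`b`. -/
theorem ncard_edgeTrees_single_edge (i₀ : ι) (d : ι → ℕ) (p : ℕ)
    [Decidable ((∀ j, j = i₀) ∧ d i₀ = 1 ∧ p = 1)] :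
    (edgeTrees (none : Option (Option (Fin 0))) (some none) i₀ d p).ncard =
      if (∀ j, j = i₀) ∧ d i₀ = 1 ∧ p = 1 then 1 else 0 := by
  have hmem : ∀ t, t ∈ edgeTrees (none : Option (Option (Fin 0))) (some none) i₀ d p ↔
      t = (swap none (some none), 1, fun _ => some none) ∧ (∀ j, j = i₀) ∧ d i₀ = 1 ∧ p = 1 := by
    rintro ⟨α, σ, ρ⟩
    constructor
    · rintro ⟨⟨h1, h2, rfl⟩, h4, h5, h6, rfl⟩
      dsimp only at h1 h2 h4 h5 h6
      have hαb : α (some none) = none := by rw [← h4, h1.involutive]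
      have hsep := h6 i₀
      rw [h5] at hsep
      have hσ : σ = 1 := by
        ext1 x
        have hx : σ.SameCycle x (σ x) := (SameCycle.refl σ x).apply_right
        rcases x with - | - | u
        · rcases hh : σ none with - | - | v
          · rfl
          · exact absurd (hh ▸ hx) hsep
          · exact v.elim0
        · rcases hh : σ (some none) with - | - | v
          · exact absurd (hh ▸ hx).symm hsep
          · rfl
          · exact v.elim0
        · exact u.elim0
      have hα : α = swap none (some none) := by
        ext1 x
        rcases x with - | - | u
        · simpa using h4
        · simpa using hαb
        · exact u.elim0
      have hρ : ∀ j, ρ j = some none := by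
        intro j
        have := h6 j
        rcases hh : ρ j with - | - | v
        · exact absurd (by rw [hh]) this
        · rfl
        · exact v.elim0
      refine ⟨by rw [hσ, hα, funext hρ], fun j => h2 _ _ (by rw [hρ, hρ]), ?_⟩
      simp [hσ, vertexDegree_one]
    · rintro ⟨ht, h1, h2, rfl⟩
      simp only [Prod.mk.injEq] at ht
      obtain ⟨rfl, rfl, rfl⟩ := ht
      refine ⟨⟨isPlaneTree_single_edge, fun i j _ => (h1 i).trans (h1 j).symm, ?_⟩, by simp,
        rfl, by simp, vertexDegree_one _⟩
      ext j
      rw [h1 j, h2]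
      exact vertexDegree_one _
  split_ifs with h
  · rw [Set.ncard_eq_one]
    exact ⟨_, Set.ext fun t => (hmem t).trans (and_iff_left h)⟩
  · rw [(Set.eq_empty_iff_forall_notMem (s := edgeTrees _ _ _ _ _)).2, Set.ncard_empty]
    exact fun t ht => h ((hmem t).1 ht).2

theorem T_recurrence_one (n : ℕ) (d : Fin n → ℕ) (p : ℕ) (hp : 1 ≤ p) (hn : n = 0 → p = 1) :
    T (n + 1) 1 le_rfl (Fin.snoc d p : Fin (n + 1) → ℕ) +
        ∑ j ∈ Finset.Icc 1 (p - 2), T (n + 1) 0 le_rfl (Fin.snoc d j : Fin (n + 1) → ℕ) =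
      ∑ i : Fin n, d i * T n 0 le_rfl (Function.update d i (d i + p - 2)) +
        T (n + 1) 0 (Nat.le_succ n) d := by
  have h := T_mul_factorial n 0 d p
  simp only [mul_zero, Nat.factorial_zero, mul_one, zero_add] at h
  have hz : ∑ j ∈ Finset.Icc 1 (p - 2),
      T (n + 1) 0 le_rfl (Fin.snoc d j : Fin (n + 1) → ℕ) = 0 := by
    refine Finset.sum_eq_zero fun j hj => ?_
    rw [T, if_pos rfl, if_neg]
    rintro ⟨-, h0⟩
    have := h0 (Fin.last n)
    rw [Fin.snoc_last] at this
    have := (Finset.mem_Icc.1 hj).1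
    omega
  rw [h, hz, add_zero]
  congr 1
  · refine Finset.sum_congr rfl fun i _ => ?_
    obtain hi | hi := Nat.eq_zero_or_pos (d i)
    · simp [hi]
    rw [ncard_edgeTrees_single_edge i d p, T, if_pos rfl]
    congr 1
    refine if_congr ?_ rfl rfl
    constructor
    · rintro ⟨h1, h2, h3⟩
      refine ⟨?_, fun j => by rw [h1 j, Function.update_self]; omega⟩
      have : Subsingleton (Fin n) := ⟨fun j k => (h1 j).trans (h1 k).symm⟩
      have := Fin.subsingleton_iff_le_one.1 this
      have := i.pos
      omega
    · rintro ⟨rfl, h2⟩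
      have := h2 i
      rw [Function.update_self] at this
      exact ⟨fun j => Subsingleton.elim _ _, by omega, by omega⟩
  · rw [Finset.sum_congr rfl fun c _ => ncard_edgeTrees_single_edge (Fin.last n) _ p]
    simp only [Fin.snoc_last]
    rw [T, if_pos rfl]
    rcases Nat.eq_zero_or_pos n with rfl | hn'
    -- With a single root the right side is 1 by convention, while the left side is 1 only for `p =
    -- 1`; this is the exceptional hypothesis.
    · simp [hn rfl]
    · rw [if_neg (by omega)]
      refine Finset.sum_eq_zero fun c _ => if_neg fun hc => ?_
      have := hc.1 0
      rw [Fin.ext_iff, Fin.val_last, Fin.val_zero] at this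
      omega

end

end PlaneTrees

theorem theorem2 (n e : ℕ) (d : Fin n → ℕ) (dN : ℕ) (he : 1 ≤ e) (hdN : 1 ≤ dN)
    (hex : n + 1 = 1 → e = 1 → dN = 1) :
    (PlaneTrees.T (n + 1) e le_rfl (Fin.snoc d dN : Fin (n + 1) → ℕ) : ℤ) =
      ∑ i : Fin n, (d i : ℤ) *
          (PlaneTrees.T n (e - 1) le_rfl (Function.update d i (d i + dN - 2)) : ℤ)
        + (PlaneTrees.T (n + 1) (e - 1) (Nat.le_succ n) d : ℤ)
        - ∑ j ∈ Finset.Icc 1 (dN - 2),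
            (PlaneTrees.T (n + 1) (e - 1) le_rfl (Fin.snoc d j : Fin (n + 1) → ℕ) : ℤ) := by
  obtain ⟨m, rfl⟩ : ∃ m, e = m + 1 := ⟨e - 1, by omega⟩
  rw [eq_sub_iff_add_eq, Nat.add_sub_cancel]
  rcases Nat.eq_zero_or_pos m with rfl | hm
  · exact_mod_cast PlaneTrees.T_recurrence_one n d dN hdN fun hn => hex (by omega) rfl
  · exact_mod_cast PlaneTrees.T_recurrence n m hm.ne' d dN hdN
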